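/- Let $k$ be a commutative ring. All dg-categories are over $k$, with differentials of degree $+1$. A dg-functor $u\colon \mathbf A\to\mathbf B$ is \emph{quasi-fully faithful} if $\mathbf A(X,Y)\to\mathbf B(uX,uY)$ is a quasi-isomorphism for all objects $X,Y$ of $\mathbf A$; it is a \emph{quasi-equivalence} if moreover $H^0(u)\colon H^0(\mathbf A)\to H^0(\mathbf B)$ is essentially surjective. If $\mathbf A$ is a dg-category strictly concentrated in nonpositive degrees (that is, $\mathbf A(X,Y)^n=0$ for $n>0$) and with strict zero objects, the dg-category $\mathrm{Tw}(\mathbf A)$ of (one-sided, unbounded) twisted complexes is defined as follows. Its objects are families $X^\bullet=(X^i,x_i^j)_{i,j\in\mathbb Z}$ of objects $X^i$ of $\mathbf A$ and morphisms $x_i^j\colon X^i\to X^j$ of degree $i-j+1$ with $(-1)^j\,d x_i^j+\sum_k x_k^jx_i^k=0$. A morphism $f\colon X^\bullet\to Y^\bullet$ of degree $p$ is a family of morphisms $f_i^j\colon X^i\to Y^j$ of degree $i-j+p$, with $$(df)_i^j=(-1)^j\,d f_i^j+\sum_k\bigl(y_k^jf_i^k-(-1)^pf_k^jx_i^k\bigr),\qquad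 (g\circ f)_i^j=\sum_k g_k^jf_i^k .$$ A dg-functor $u$ between such dg-categories induces $\mathrm{Tw}(u)$ by $(X^i,x_i^j)\mapsto(u(X^i),u(x_i^j))$ and $\mathrm{Tw}(u)(f)_i^j=u(f_i^j)$. For an arbitrary dg-category $\mathbf A$ and an arbitrary dg-functor $u$ one sets $\mathrm{Tw}(\mathbf A)=\mathrm{Tw}(\tau_{\le 0}\mathbf A_{\{0\}})$ and $\mathrm{Tw}(u)=\mathrm{Tw}(\tau_{\le 0}u_{\{0\}})$, where $(-)_{\{0\}}$ formally adds a strict zero object and $\tau_{\le0}$ is the truncation of the complexes of morphisms (all of degree $n<0$, the cocycles in degree $0$, zero in degree $n>0$). \textbf{Claim.} Let $u\colon\mathbf A\to\mathbf B$ be a dg-functor. (1) If $u$ is quasi-fully faithful, then $\mathrm{Tw}(u)\colon\mathrm{Tw}(\mathbf A)\to\mathrm{Tw}(\mathbf B)$ is quasi-fully faithful. (2) If $u$ is a quasi-equivalence, then $\mathrm{Tw}(u)$ is a quasi-equivalence. Both hold for arbitrary $\mathbf A,\mathbf B$ with the second definition of $\mathrm{Tw}$, and for $\mathbf A,\mathbf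 B$ strictly concentrated in nonpositive degrees and with strict zero objects with the first definition. (3) Consequently (with the second definition) $\mathrm{Tw}(\mathbf A)$ depends only on the quasi-equivalence class of $\mathbf A$: if $\mathbf A$ and $\mathbf B$ are joined by a finite zigzag of quasi-equivalences, then so are $\mathrm{Tw}(\mathbf A)$ and $\mathrm{Tw}(\mathbf B)$; and if $\mathbf A$ and $\mathbf B$ are isomorphic in the homotopy category $\mathsf{Hqe}$ of dg-categories (the localization of the category of dg-categories at the quasi-equivalences), then so are $\mathrm{Tw}(\mathbf A)$ and $\mathrm{Tw}(\mathbf B)$. -/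

import Mathlib

open CategoryTheory

universe w u v u' v'

/-- A dg-category over `k`: a category enriched in cochain complexes of `k`-modules, written out.
`Hom X Y n` is the degree `n` part of the complex of morphisms, `d` its differential, and
`comp h g f` is the composition `g ∘ f` of `f` of degree `p` and `g` of degree `q`, which has degree
`r = p + q`. -/
structure DGCat (k : Type w) [CommRing k] where
  Obj : Type u
  Hom : Obj → Obj → ℤ → Type v
  [addCommGroup : ∀ X Y n, AddCommGroup (Hom X Y n)]
  [module : ∀ X Y n, Module k (Hom X Y n)]
  d : ∀ {X Y : Obj} {n m : ℤ}, n + 1 = m → Hom X Y n →ₗ[k] Hom X Y m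
  comp : ∀ {X Y Z : Obj} {p q r : ℤ}, p + q = r →
    Hom Y Z q →ₗ[k] Hom X Y p →ₗ[k] Hom X Z r
  id : ∀ X : Obj, Hom X X 0
  d_d : ∀ {X Y : Obj} {n m l : ℤ} (h : n + 1 = m) (h' : m + 1 = l) (f : Hom X Y n),
    d h' (d h f) = 0
  d_id : ∀ X : Obj, d (zero_add 1) (id X) = 0
  /-- The graded Leibniz rule: composition is a chain map. -/
  d_comp : ∀ {X Y Z : Obj} {p q r p' q' r' : ℤ} (h : p + q = r) (hp : p + 1 = p')
    (hq : q + 1 = q') (hr : r + 1 = r') (g : Hom Y Z q) (f : Hom X Y p),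
    d hr (comp h g f) =
      comp (show p + q' = r' by lia) (d hq g) f +
        q.negOnePow • comp (show p' + q = r' by lia) g (d hp f)
  id_comp : ∀ {X Y : Obj} {n : ℤ} (f : Hom X Y n), comp (add_zero n) (id Y) f = f
  comp_id : ∀ {X Y : Obj} {n : ℤ} (f : Hom X Y n), comp (zero_add n) f (id X) = f
  assoc : ∀ {X Y Z W : Obj} {p q s pq qs t : ℤ} (h₁ : q + s = qs) (h₂ : p + qs = t)
    (h₃ : p + q = pq) (h₄ : pq + s = t) (e : Hom Z W s) (g : Hom Y Z q) (f : Hom X Y p),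
    comp h₂ (comp h₁ e g) f = comp h₄ e (comp h₃ g f)

attribute [instance] DGCat.addCommGroup DGCat.module

/-- A dg-functor: a map on objects together with `k`-linear maps on the complexes of morphisms,
compatible with differentials, compositions and identities. -/
@[ext]
structure DGFunctor {k : Type w} [CommRing k] (A : DGCat.{w, u, v} k) (B : DGCat.{w, u', v'} k) where
  obj : A.Obj → B.Obj
  map : ∀ {X Y : A.Obj} {n : ℤ}, A.Hom X Y n →ₗ[k] B.Hom (obj X) (obj Y) n
  map_d : ∀ {X Y : A.Obj} {n m : ℤ} (h : n + 1 = m) (f : A.Hom X Y n),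
    map (A.d h f) = B.d h (map f)
  map_comp : ∀ {X Y Z : A.Obj} {p q r : ℤ} (h : p + q = r) (g : A.Hom Y Z q) (f : A.Hom X Y p),
    map (A.comp h g f) = B.comp h (map g) (map f)
  map_id : ∀ X : A.Obj, map (A.id X) = B.id (obj X)

namespace DGCat

variable {k : Type w} [CommRing k]

/-- The category of dg-categories over `k` (of fixed sizes) and dg-functors. -/
instance : Category (DGCat.{w, u, v} k) where
  Hom A B := DGFunctor A B
  id A :=
    { obj := fun X => X
      map := LinearMap.id
      map_d := fun _ _ => rfl
      map_comp := fun _ _ _ => rfl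
      map_id := fun _ => rfl }
  comp F G :=
    { obj := fun X => G.obj (F.obj X)
      map := G.map ∘ₗ F.map
      map_d := fun h f => by simp [F.map_d, G.map_d]
      map_comp := fun h g f => by simp [F.map_comp, G.map_comp]
      map_id := fun X => by simp [F.map_id, G.map_id] }

/-! ### Cohomology, the homotopy category, quasi-equivalences -/

/-- `Zⁿ(A(X,Y))`. -/
def cycles (A : DGCat.{w, u, v} k) (X Y : A.Obj) (n : ℤ) : Submodule k (A.Hom X Y n) :=
  LinearMap.ker (A.d (rfl : n + 1 = n + 1))

/-- `Bⁿ(A(X,Y))`. -/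
def boundaries (A : DGCat.{w, u, v} k) (X Y : A.Obj) (n : ℤ) : Submodule k (A.Hom X Y n) :=
  LinearMap.range (A.d (sub_add_cancel n 1))

/-- `Hⁿ(A(X,Y)) = Zⁿ / Bⁿ`. -/
abbrev cohomology (A : DGCat.{w, u, v} k) (X Y : A.Obj) (n : ℤ) : Type v :=
  A.cycles X Y n ⧸ (A.boundaries X Y n).submoduleOf (A.cycles X Y n)

theorem comp_mem_cycles (A : DGCat.{w, u, v} k) {X Y Z : A.Obj} {g : A.Hom Y Z 0} {f : A.Hom X Y 0}
    (hg : g ∈ A.cycles Y Z 0) (hf : f ∈ A.cycles X Y 0) :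
    A.comp (add_zero 0) g f ∈ A.cycles X Z 0 := by
  have hg' : A.d (rfl : (0 : ℤ) + 1 = 0 + 1) g = 0 := hg
  have hf' : A.d (rfl : (0 : ℤ) + 1 = 0 + 1) f = 0 := hf
  change A.d _ _ = 0
  rw [A.d_comp _ rfl rfl, hg', hf']
  simp

theorem comp_sub_mem_boundaries (A : DGCat.{w, u, v} k) {X Y Z : A.Obj} {g g' : A.Hom Y Z 0}
    {f f' : A.Hom X Y 0} (hg : g ∈ A.cycles Y Z 0) (hf' : f' ∈ A.cycles X Y 0)
    (hgg : g - g' ∈ A.boundaries Y Z 0) (hff : f - f' ∈ A.boundaries X Y 0) :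
    A.comp (add_zero 0) g f - A.comp (add_zero 0) g' f' ∈ A.boundaries X Z 0 := by
  obtain ⟨a, ha⟩ := hff
  obtain ⟨b, hb⟩ := hgg
  have hg₀ : A.d (rfl : (0 : ℤ) + 1 = 0 + 1) g = 0 := hg
  have hf₀ : A.d (rfl : (0 : ℤ) + 1 = 0 + 1) f' = 0 := hf'
  refine ⟨A.comp (by lia) g a + A.comp (by lia) b f', ?_⟩
  rw [map_add, A.d_comp _ (sub_add_cancel 0 1) rfl, A.d_comp _ rfl (sub_add_cancel 0 1), hg₀, hf₀,
    ha, hb]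
  simp

/-- The homotopy category `H⁰(A)`: the objects of `A`, with morphisms `H⁰(A(X,Y))`. -/
structure H0 (A : DGCat.{w, u, v} k) where
  of : A.Obj

instance (A : DGCat.{w, u, v} k) : Category (H0 A) where
  Hom X Y := A.cohomology X.of Y.of 0
  id X := Submodule.Quotient.mk ⟨A.id X.of, A.d_id X.of⟩
  comp {X Y Z} f g :=
    Quotient.map₂ (fun f g => ⟨A.comp (add_zero 0) g.1 f.1, A.comp_mem_cycles g.2 f.2⟩)
      (fun f f' hf g g' hg => by
        exact (Submodule.quotientRel_def _).2 (A.comp_sub_mem_boundaries g.2 f'.2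
          ((Submodule.quotientRel_def (p := (A.boundaries _ _ 0).submoduleOf _)).1 hg)
          ((Submodule.quotientRel_def (p := (A.boundaries _ _ 0).submoduleOf _)).1 hf))) f g
  id_comp f := by
    induction f using Submodule.Quotient.induction_on with
    | H f => exact congrArg Submodule.Quotient.mk (Subtype.ext (A.comp_id f.1))
  comp_id f := by
    induction f using Submodule.Quotient.induction_on with
    | H f => exact congrArg Submodule.Quotient.mk (Subtype.ext (A.id_comp f.1))
  assoc f g h := by
    induction f using Submodule.Quotient.induction_on with
    | H f =>
    induction g using Submodule.Quotient.induction_on with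
    | H g =>
    induction h using Submodule.Quotient.induction_on with
    | H h => exact congrArg Submodule.Quotient.mk (Subtype.ext (A.assoc _ _ _ _ h.1 g.1 f.1).symm)

end DGCat

namespace DGFunctor

variable {k : Type w} [CommRing k] {A : DGCat.{w, u, v} k} {B : DGCat.{w, u', v'} k}

/-- The map `Hⁿ(A(X,Y)) → Hⁿ(B(uX,uY))` induced by a dg-functor `u`. -/
def cohomologyMap (F : DGFunctor A B) (X Y : A.Obj) (n : ℤ) :
    A.cohomology X Y n →ₗ[k] B.cohomology (F.obj X) (F.obj Y) n :=
  Submodule.mapQ _ _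
    (F.map.restrict (p := A.cycles X Y n) (q := B.cycles (F.obj X) (F.obj Y) n) (fun f hf => by
      have hf' : A.d _ f = 0 := hf
      change B.d _ (F.map f) = 0
      rw [← F.map_d, hf', map_zero]))
    (by
      rintro ⟨f, hf⟩ ⟨e, he⟩
      exact ⟨F.map e, by rw [← F.map_d, he]; rfl⟩)

/-- A dg-functor is quasi-fully faithful if it induces quasi-isomorphisms on the complexes of
morphisms. -/
def QuasiFullyFaithful (F : DGFunctor A B) : Prop :=
  ∀ (X Y : A.Obj) (n : ℤ), Function.Bijective (F.cohomologyMap X Y n)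

/-- The functor `H⁰(u) : H⁰(A) ⥤ H⁰(B)`. -/
def mapH0 (F : DGFunctor A B) : A.H0 ⥤ B.H0 where
  obj X := ⟨F.obj X.of⟩
  map {X Y} f := F.cohomologyMap X.of Y.of 0 f
  map_id X := congrArg Submodule.Quotient.mk (Subtype.ext (F.map_id X.of))
  map_comp f g := by
    induction f using Submodule.Quotient.induction_on with
    | H f =>
    induction g using Submodule.Quotient.induction_on with
    | H g => exact congrArg Submodule.Quotient.mk (Subtype.ext (F.map_comp _ g.1 f.1))

/-- A dg-functor is a quasi-equivalence if it is quasi-fully faithful and `H⁰(u)` is essentially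
surjective. -/
structure IsQuasiEquivalence (F : DGFunctor A B) : Prop where
  quasiFullyFaithful : F.QuasiFullyFaithful
  essSurj : F.mapH0.EssSurj

end DGFunctor

namespace DGCat

variable {k : Type w} [CommRing k]

/-- `A` is strictly concentrated in nonpositive degrees. -/
class IsNonpositive (A : DGCat.{w, u, v} k) : Prop where
  eq_zero : ∀ {X Y : A.Obj} {n : ℤ}, 0 < n → ∀ f : A.Hom X Y n, f = 0

/-- `A` has a strict zero object: an object all of whose complexes of morphisms, from it and to it,
are zero. -/
def HasStrictZero (A : DGCat.{w, u, v} k) : Prop :=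
  ∃ Z : A.Obj, ∀ (X : A.Obj) (n : ℤ), Subsingleton (A.Hom X Z n) ∧ Subsingleton (A.Hom Z X n)

/-! ### Formally adding a zero object -/

section AddZero

variable (A : DGCat.{w, u, v} k)

/-- The morphisms of `A_{0}`; the formal zero object is `none`. -/
def addZeroHom : Option A.Obj → Option A.Obj → ℤ → Type v
  | some X, some Y, n => A.Hom X Y n
  | some _, none, _ => PUnit
  | none, _, _ => PUnit

instance : ∀ (X Y : Option A.Obj) (n : ℤ), AddCommGroup (A.addZeroHom X Y n)
  | some X, some Y, n => inferInstanceAs (AddCommGroup (A.Hom X Y n))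
  | some _, none, _ => inferInstanceAs (AddCommGroup PUnit)
  | none, _, _ => inferInstanceAs (AddCommGroup PUnit)

instance : ∀ (X : Option A.Obj) (n : ℤ), Subsingleton (A.addZeroHom X none n)
  | some _, _ => inferInstanceAs (Subsingleton PUnit)
  | none, _ => inferInstanceAs (Subsingleton PUnit)

instance (X : Option A.Obj) (n : ℤ) : Subsingleton (A.addZeroHom none X n) :=
  inferInstanceAs (Subsingleton PUnit)

/-- The (unique) module structure on a zero group. -/
abbrev subsingletonModule (M : Type v) [AddCommGroup M] [Subsingleton M] : Module k M where
  smul _ _ := 0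
  one_smul _ := Subsingleton.elim _ _
  mul_smul _ _ _ := Subsingleton.elim _ _
  smul_zero _ := Subsingleton.elim _ _
  smul_add _ _ _ := Subsingleton.elim _ _
  add_smul _ _ _ := Subsingleton.elim _ _
  zero_smul _ := Subsingleton.elim _ _

instance : ∀ (X Y : Option A.Obj) (n : ℤ), Module k (A.addZeroHom X Y n)
  | some X, some Y, n => inferInstanceAs (Module k (A.Hom X Y n))
  | some X, none, n => subsingletonModule (A.addZeroHom (some X) none n)
  | none, Y, n => subsingletonModule (A.addZeroHom none Y n)

def addZeroD : ∀ {X Y : Option A.Obj} {n m : ℤ}, n + 1 = m →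
    A.addZeroHom X Y n →ₗ[k] A.addZeroHom X Y m
  | some _, some _, _, _, h => A.d h
  | some _, none, _, _, _ => 0
  | none, _, _, _, _ => 0

def addZeroComp : ∀ {X Y Z : Option A.Obj} {p q r : ℤ}, p + q = r →
    A.addZeroHom Y Z q →ₗ[k] A.addZeroHom X Y p →ₗ[k] A.addZeroHom X Z r
  | some _, some _, some _, _, _, _, h => A.comp h
  | none, _, _, _, _, _, _ => 0
  | some _, none, _, _, _, _, _ => 0
  | some _, some _, none, _, _, _, _ => 0

def addZeroId : ∀ X : Option A.Obj, A.addZeroHom X X 0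
  | some X => A.id X
  | none => 0

/-- The dg-category `A_{0}`, obtained from `A` by formally adding a strict zero object. -/
def addZero : DGCat.{w, u, v} k where
  Obj := Option A.Obj
  Hom := A.addZeroHom
  d := A.addZeroD
  comp := A.addZeroComp
  id := A.addZeroId
  d_d := by
    rintro (_ | X) (_ | Y) n m l h h' f
    any_goals (first | exact Subsingleton.elim _ _ | skip)
    exact A.d_d h h' f
  d_id := by
    rintro (_ | X)
    · exact Subsingleton.elim _ _
    · exact A.d_id X
  d_comp := by
    rintro (_ | X) (_ | Y) (_ | Z) p q r p' q' r' h hp hq hr g f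
    any_goals (first | exact Subsingleton.elim _ _ | skip)
    · obtain rfl := Subsingleton.elim f 0
      simp [addZeroComp]
    · exact A.d_comp h hp hq hr g f
  id_comp := by
    rintro (_ | X) (_ | Y) n f
    any_goals (first | exact Subsingleton.elim _ _ | skip)
    exact A.id_comp f
  comp_id := by
    rintro (_ | X) (_ | Y) n f
    any_goals (first | exact Subsingleton.elim _ _ | skip)
    exact A.comp_id f
  assoc := by
    rintro (_ | X) (_ | Y) (_ | Z) (_ | W) p q s pq qs t h₁ h₂ h₃ h₄ e g f
    any_goals (first | exact Subsingleton.elim _ _ | skip)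
    · obtain rfl := Subsingleton.elim f 0
      simp
    · obtain rfl := Subsingleton.elim f 0
      simp
    · obtain rfl := Subsingleton.elim g 0
      simp
    · exact A.assoc h₁ h₂ h₃ h₄ e g f

end AddZero

theorem addZero_ext_left {A : DGCat.{w, u, v} k} {X : Option A.Obj} {n : ℤ}
    (f g : A.addZero.Hom none X n) : f = g :=
  Subsingleton.elim (α := A.addZeroHom none X n) f g

theorem addZero_ext_right {A : DGCat.{w, u, v} k} {X : Option A.Obj} {n : ℤ}
    (f g : A.addZero.Hom X none n) : f = g :=
  Subsingleton.elim (α := A.addZeroHom X none n) f g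

def addZeroMapHom {A : DGCat.{w, u, v} k} {B : DGCat.{w, u', v'} k} (F : DGFunctor A B) :
    ∀ {X Y : Option A.Obj} {n : ℤ},
      A.addZeroHom X Y n →ₗ[k] B.addZeroHom (X.map F.obj) (Y.map F.obj) n
  | some _, some _, _ => F.map
  | some _, none, _ => 0
  | none, _, _ => 0

/-- The dg-functor `u_{0} : A_{0} → B_{0}`. -/
def addZeroMap {A : DGCat.{w, u, v} k} {B : DGCat.{w, u', v'} k} (F : DGFunctor A B) :
    DGFunctor A.addZero B.addZero where
  obj := Option.map F.obj
  map := addZeroMapHom F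
  map_d := by
    rintro (_ | X) (_ | Y) n m h f
    · exact addZero_ext_left _ _
    · exact addZero_ext_left _ _
    · exact addZero_ext_right _ _
    · exact F.map_d h f
  map_comp := by
    rintro (_ | X) (_ | Y) (_ | Z) p q r h g f
    · exact addZero_ext_left _ _
    · exact addZero_ext_left _ _
    · exact addZero_ext_left _ _
    · exact addZero_ext_left _ _
    · exact addZero_ext_right _ _
    · exact (F.map (X := X) (Y := Z) (n := r)).map_zero
    · exact addZero_ext_right _ _
    · exact F.map_comp h g f
  map_id := by
    rintro (_ | X)
    · exact addZero_ext_left _ _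
    · exact F.map_id X

/-! ### Truncation -/

section Trunc

variable (A : DGCat.{w, u, v} k)

/-- The degree `n` part of `τ_{≤ 0} A(X,Y)`: everything for `n < 0`, the cycles for `n = 0`, zero for
`n > 0`. -/
def truncHom (X Y : A.Obj) (n : ℤ) : Submodule k (A.Hom X Y n) where
  carrier := {f | (n = 0 → A.d (rfl : n + 1 = n + 1) f = 0) ∧ (0 < n → f = 0)}
  add_mem' := by
    rintro f g ⟨h₁, h₂⟩ ⟨h₁', h₂'⟩
    exact ⟨fun h => by rw [map_add, h₁ h, h₁' h, add_zero],
      fun h => by rw [h₂ h, h₂' h, add_zero]⟩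
  zero_mem' := ⟨fun _ => map_zero _, fun _ => rfl⟩
  smul_mem' := by
    rintro c f ⟨h₁, h₂⟩
    exact ⟨fun h => by rw [map_smul, h₁ h, smul_zero], fun h => by rw [h₂ h, smul_zero]⟩

variable {A}

theorem truncHom_d_mem {X Y : A.Obj} {n m : ℤ} (h : n + 1 = m) {f : A.Hom X Y n}
    (hf : f ∈ A.truncHom X Y n) : A.d h f ∈ A.truncHom X Y m := by
  refine ⟨fun _ => A.d_d h rfl f, fun hm => ?_⟩
  subst h
  rcases (show 0 ≤ n by lia).eq_or_lt with h0 | h0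
  · exact hf.1 h0.symm
  · rw [hf.2 h0, map_zero]

theorem truncHom_comp_mem {X Y Z : A.Obj} {p q r : ℤ} (h : p + q = r) {g : A.Hom Y Z q}
    {f : A.Hom X Y p} (hg : g ∈ A.truncHom Y Z q) (hf : f ∈ A.truncHom X Y p) :
    A.comp h g f ∈ A.truncHom X Z r := by
  by_cases hp : 0 < p
  · rw [hf.2 hp, map_zero]; exact zero_mem _
  by_cases hq : 0 < q
  · rw [hg.2 hq, map_zero]; exact zero_mem _
  refine ⟨fun hr => ?_, fun hr => by lia⟩
  rw [A.d_comp h rfl rfl rfl, hg.1 (by lia), hf.1 (by lia)]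
  simp

variable (A)

/-- The truncation `τ_{≤ 0} A`. -/
def trunc : DGCat.{w, u, v} k where
  Obj := A.Obj
  Hom X Y n := A.truncHom X Y n
  d h := (A.d h).restrict fun _ hf => truncHom_d_mem h hf
  comp h := LinearMap.mk₂ k (fun g f => ⟨A.comp h g.1 f.1, truncHom_comp_mem h g.2 f.2⟩)
    (fun _ _ _ => Subtype.ext (by simp)) (fun _ _ _ => Subtype.ext (by simp))
    (fun _ _ _ => Subtype.ext (by simp)) (fun _ _ _ => Subtype.ext (by simp))
  id X := ⟨A.id X, fun _ => A.d_id X, fun h => absurd h (lt_irrefl 0)⟩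
  d_d h h' f := Subtype.ext (A.d_d h h' f.1)
  d_id X := Subtype.ext (A.d_id X)
  d_comp h hp hq hr g f := Subtype.ext (by
    rw [Units.smul_def]
    simpa [Units.smul_def] using A.d_comp h hp hq hr g.1 f.1)
  id_comp f := Subtype.ext (A.id_comp f.1)
  comp_id f := Subtype.ext (A.comp_id f.1)
  assoc h₁ h₂ h₃ h₄ e g f := Subtype.ext (A.assoc h₁ h₂ h₃ h₄ e.1 g.1 f.1)

instance : A.trunc.IsNonpositive := ⟨fun h f => Subtype.ext (f.2.2 h)⟩

end Trunc

theorem truncMap_mem {A : DGCat.{w, u, v} k} {B : DGCat.{w, u', v'} k} (F : DGFunctor A B)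
    {X Y : A.Obj} {n : ℤ} {f : A.Hom X Y n} (hf : f ∈ A.truncHom X Y n) :
    F.map f ∈ B.truncHom (F.obj X) (F.obj Y) n :=
  ⟨fun h => by rw [← F.map_d, hf.1 h, map_zero], fun h => by rw [hf.2 h, map_zero]⟩

def truncMapHom {A : DGCat.{w, u, v} k} {B : DGCat.{w, u', v'} k} (F : DGFunctor A B)
    (X Y : A.Obj) (n : ℤ) : A.truncHom X Y n →ₗ[k] B.truncHom (F.obj X) (F.obj Y) n :=
  F.map.restrict fun _ hf => truncMap_mem F hf

/-- The dg-functor `τ_{≤ 0} u : τ_{≤ 0} A → τ_{≤ 0} B`. -/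
def truncMap {A : DGCat.{w, u, v} k} {B : DGCat.{w, u', v'} k} (F : DGFunctor A B) :
    DGFunctor A.trunc B.trunc where
  obj := F.obj
  map {X Y n} := truncMapHom F X Y n
  map_d h f := Subtype.ext (F.map_d h f.1)
  map_comp h g f := Subtype.ext (F.map_comp h g.1 f.1)
  map_id X := Subtype.ext (F.map_id X)

/-! ### Twisted complexes -/

section Tw

variable (A : DGCat.{w, u, v} k)

/-- Families `f_i^j : X^i → Y^j` of morphisms of degree `i - j + p`; the component `f_i^j` is
`f i j`. -/
abbrev Family (X Y : ℤ → A.Obj) (p : ℤ) : Type v := ∀ i j : ℤ, A.Hom (X i) (Y j) (i - j + p)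

variable {A}

/-- `(g ∘ f)_i^j = ∑_k g_k^j f_i^k`. -/
noncomputable def Family.comp {X Y Z : ℤ → A.Obj} {p q r : ℤ} (h : p + q = r)
    (g : A.Family Y Z q) (f : A.Family X Y p) : A.Family X Z r :=
  fun i j => ∑ᶠ l : ℤ, A.comp (show (i - l + p) + (l - j + q) = i - j + r by lia) (g l j) (f i l)

/-- The family with components `(-1)^j d f_i^j`. -/
def Family.diff {X Y : ℤ → A.Obj} {p q : ℤ} (h : p + 1 = q) (f : A.Family X Y p) :
    A.Family X Y q :=
  fun i j => j.negOnePow • A.d (show (i - j + p) + 1 = i - j + q by lia) (f i j)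

/-- The identity of `X`, viewed as a morphism `X → Y` of degree `n`, if `X = Y` and `n = 0`. -/
def idCast {X Y : A.Obj} {n : ℤ} (h : X = Y) (hn : 0 = n) : A.Hom X Y n :=
  h ▸ hn ▸ A.id X

/-- The identity family: `1_{X^i}` for `i = j`, zero otherwise. -/
def Family.id (X : ℤ → A.Obj) : A.Family X X 0 :=
  fun i j => if h : i = j then A.idCast (congrArg X h) (by lia) else 0

theorem idCast_comp {X Y Z : A.Obj} {n p r : ℤ} (h : Y = Z) (hn : 0 = n) (hr : p + n = r)
    (f : A.Hom X Y p) (e : A.Hom X Z r) (he : HEq f e) : A.comp hr (A.idCast h hn) f = e := by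
  subst h; subst hn
  obtain rfl : p = r := by lia
  obtain rfl := eq_of_heq he
  exact A.id_comp f

theorem comp_idCast {X Y Z : A.Obj} {n p r : ℤ} (h : X = Y) (hn : 0 = n) (hr : n + p = r)
    (f : A.Hom Y Z p) (e : A.Hom X Z r) (he : HEq f e) : A.comp hr f (A.idCast h hn) = e := by
  subst h; subst hn
  obtain rfl : p = r := by lia
  obtain rfl := eq_of_heq he
  exact A.comp_id f

theorem d_idCast {X Y : A.Obj} {n m : ℤ} (h : X = Y) (hn : 0 = n) (hm : n + 1 = m) :
    A.d hm (A.idCast h hn) = 0 := by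
  subst h; subst hn; subst hm
  exact A.d_id X

section

variable [A.IsNonpositive]

theorem comp_eq_zero {X Y Z : A.Obj} {p q r : ℤ} (h : p + q = r) (g : A.Hom Y Z q)
    (f : A.Hom X Y p) (hpq : 0 < p ∨ 0 < q) : A.comp h g f = 0 := by
  rcases hpq with hp | hq
  · rw [IsNonpositive.eq_zero hp f, map_zero]
  · rw [IsNonpositive.eq_zero hq g, map_zero, LinearMap.zero_apply]

theorem Family.support_subset {X Y Z : ℤ → A.Obj} {p q r : ℤ} (h : p + q = r)
    (g : A.Family Y Z q) (f : A.Family X Y p) (i j : ℤ) :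
    (Function.support fun l : ℤ =>
      A.comp (show (i - l + p) + (l - j + q) = i - j + r by lia) (g l j) (f i l)) ⊆
        Finset.Icc (i + p) (j - q) := by
  intro l hl
  by_contra hl'
  refine hl (comp_eq_zero _ _ _ ?_)
  simp only [Finset.coe_Icc, Set.mem_Icc] at hl'
  lia

theorem Family.finite_support {X Y Z : ℤ → A.Obj} {p q r : ℤ} (h : p + q = r)
    (g : A.Family Y Z q) (f : A.Family X Y p) (i j : ℤ) :
    (Function.support fun l : ℤ =>
      A.comp (show (i - l + p) + (l - j + q) = i - j + r by lia) (g l j) (f i l)).Finite :=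
  (Finset.finite_toSet _).subset (Family.support_subset h g f i j)

theorem Family.comp_apply {X Y Z : ℤ → A.Obj} {p q r : ℤ} (h : p + q = r)
    (g : A.Family Y Z q) (f : A.Family X Y p) (i j : ℤ) (s : Finset ℤ)
    (hs : Finset.Icc (i + p) (j - q) ⊆ s) :
    Family.comp h g f i j = ∑ l ∈ s,
      A.comp (show (i - l + p) + (l - j + q) = i - j + r by lia) (g l j) (f i l) :=
  finsum_eq_sum_of_support_subset _
    ((Family.support_subset h g f i j).trans (Finset.coe_subset.2 hs))

theorem Family.comp_add {X Y Z : ℤ → A.Obj} {p q r : ℤ} (h : p + q = r)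
    (g : A.Family Y Z q) (f f' : A.Family X Y p) :
    Family.comp h g (f + f') = Family.comp h g f + Family.comp h g f' := by
  ext i j
  simp only [Pi.add_apply, Family.comp_apply h _ _ i j _ subset_rfl, map_add,
    Finset.sum_add_distrib]

theorem Family.add_comp {X Y Z : ℤ → A.Obj} {p q r : ℤ} (h : p + q = r)
    (g g' : A.Family Y Z q) (f : A.Family X Y p) :
    Family.comp h (g + g') f = Family.comp h g f + Family.comp h g' f := by
  ext i j
  simp only [Pi.add_apply, Family.comp_apply h _ _ i j _ subset_rfl, map_add,
    LinearMap.add_apply, Finset.sum_add_distrib]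

theorem Family.comp_smul {X Y Z : ℤ → A.Obj} {p q r : ℤ} (h : p + q = r) (c : k)
    (g : A.Family Y Z q) (f : A.Family X Y p) :
    Family.comp h g (c • f) = c • Family.comp h g f := by
  ext i j
  simp only [Pi.smul_apply, Family.comp_apply h _ _ i j _ subset_rfl, map_smul,
    Finset.smul_sum]

theorem Family.smul_comp {X Y Z : ℤ → A.Obj} {p q r : ℤ} (h : p + q = r) (c : k)
    (g : A.Family Y Z q) (f : A.Family X Y p) :
    Family.comp h (c • g) f = c • Family.comp h g f := by
  ext i j
  simp only [Pi.smul_apply, Family.comp_apply h _ _ i j _ subset_rfl, map_smul,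
    LinearMap.smul_apply, Finset.smul_sum]

theorem Family.assoc {X Y Z W : ℤ → A.Obj} {p q s pq qs t : ℤ} (h₁ : q + s = qs)
    (h₂ : p + qs = t) (h₃ : p + q = pq) (h₄ : pq + s = t) (e : A.Family Z W s)
    (g : A.Family Y Z q) (f : A.Family X Y p) :
    Family.comp h₂ (Family.comp h₁ e g) f = Family.comp h₄ e (Family.comp h₃ g f) := by
  ext i j
  rw [Family.comp_apply h₂ _ _ i j _ subset_rfl, Family.comp_apply h₄ _ _ i j _ subset_rfl]
  have hl : ∀ l ∈ Finset.Icc (i + p) (j - qs),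
      Family.comp h₁ e g l j = ∑ m ∈ Finset.Icc (i + pq) (j - s),
        A.comp (show (l - m + q) + (m - j + s) = l - j + qs by lia) (e m j) (g l m) := by
    intro l hl
    refine Family.comp_apply h₁ e g l j _ (Finset.Icc_subset_Icc ?_ le_rfl)
    rw [Finset.mem_Icc] at hl; lia
  have hm : ∀ m ∈ Finset.Icc (i + pq) (j - s),
      Family.comp h₃ g f i m = ∑ l ∈ Finset.Icc (i + p) (j - qs),
        A.comp (show (i - l + p) + (l - m + q) = i - m + pq by lia) (g l m) (f i l) := by
    intro m hm
    refine Family.comp_apply h₃ g f i m _ (Finset.Icc_subset_Icc le_rfl ?_)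
    rw [Finset.mem_Icc] at hm; lia
  have e₁ : ∀ l ∈ Finset.Icc (i + p) (j - qs),
      A.comp (show (i - l + p) + (l - j + qs) = i - j + t by lia) (Family.comp h₁ e g l j) (f i l) =
        ∑ m ∈ Finset.Icc (i + pq) (j - s),
          A.comp (show (i - m + pq) + (m - j + s) = i - j + t by lia) (e m j)
            (A.comp (show (i - l + p) + (l - m + q) = i - m + pq by lia) (g l m) (f i l)) := by
    intro l hl'
    rw [hl l hl', map_sum, LinearMap.sum_apply]
    exact Finset.sum_congr rfl fun m _ => A.assoc _ _ _ _ (e m j) (g l m) (f i l)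
  have e₂ : ∀ m ∈ Finset.Icc (i + pq) (j - s),
      A.comp (show (i - m + pq) + (m - j + s) = i - j + t by lia) (e m j) (Family.comp h₃ g f i m) =
        ∑ l ∈ Finset.Icc (i + p) (j - qs),
          A.comp (show (i - m + pq) + (m - j + s) = i - j + t by lia) (e m j)
            (A.comp (show (i - l + p) + (l - m + q) = i - m + pq by lia) (g l m) (f i l)) := by
    intro m hm'
    rw [hm m hm', map_sum]
  rw [Finset.sum_congr rfl e₁, Finset.sum_congr rfl e₂, Finset.sum_comm]

theorem Family.zero_comp {X Y Z : ℤ → A.Obj} {p q r : ℤ} (h : p + q = r) (f : A.Family X Y p) :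
    Family.comp h (0 : A.Family Y Z q) f = 0 := by
  simpa using Family.smul_comp h 0 (0 : A.Family Y Z q) f

theorem Family.comp_zero {X Y Z : ℤ → A.Obj} {p q r : ℤ} (h : p + q = r) (g : A.Family Y Z q) :
    Family.comp h g (0 : A.Family X Y p) = 0 := by
  simpa using Family.comp_smul h 0 g (0 : A.Family X Y p)

theorem Family.neg_comp {X Y Z : ℤ → A.Obj} {p q r : ℤ} (h : p + q = r) (g : A.Family Y Z q)
    (f : A.Family X Y p) : Family.comp h (-g) f = -Family.comp h g f := by
  simpa using Family.smul_comp h (-1) g f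

theorem Family.comp_neg {X Y Z : ℤ → A.Obj} {p q r : ℤ} (h : p + q = r) (g : A.Family Y Z q)
    (f : A.Family X Y p) : Family.comp h g (-f) = -Family.comp h g f := by
  simpa using Family.comp_smul h (-1) g f

theorem Family.sub_comp {X Y Z : ℤ → A.Obj} {p q r : ℤ} (h : p + q = r) (g g' : A.Family Y Z q)
    (f : A.Family X Y p) :
    Family.comp h (g - g') f = Family.comp h g f - Family.comp h g' f := by
  rw [sub_eq_add_neg, Family.add_comp, Family.neg_comp, sub_eq_add_neg]

theorem Family.comp_sub {X Y Z : ℤ → A.Obj} {p q r : ℤ} (h : p + q = r) (g : A.Family Y Z q)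
    (f f' : A.Family X Y p) :
    Family.comp h g (f - f') = Family.comp h g f - Family.comp h g f' := by
  rw [sub_eq_add_neg, Family.comp_add, Family.comp_neg, sub_eq_add_neg]

theorem Family.units_smul_comp {X Y Z : ℤ → A.Obj} {p q r : ℤ} (h : p + q = r) (c : ℤˣ)
    (g : A.Family Y Z q) (f : A.Family X Y p) :
    Family.comp h (c • g) f = c • Family.comp h g f := by
  rcases Int.units_eq_one_or c with rfl | rfl
  · simp
  · simpa using Family.neg_comp h g f

theorem Family.comp_units_smul {X Y Z : ℤ → A.Obj} {p q r : ℤ} (h : p + q = r) (c : ℤˣ)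
    (g : A.Family Y Z q) (f : A.Family X Y p) :
    Family.comp h g (c • f) = c • Family.comp h g f := by
  rcases Int.units_eq_one_or c with rfl | rfl
  · simp
  · simpa using Family.comp_neg h g f

theorem Family.id_comp {X Y : ℤ → A.Obj} {p : ℤ} (f : A.Family X Y p) :
    Family.comp (add_zero p) (Family.id Y) f = f := by
  ext i j
  rw [Family.comp_apply (add_zero p) _ _ i j _ (Finset.subset_insert j _),
    Finset.sum_eq_single_of_mem j (Finset.mem_insert_self _ _)]
  · simp only [Family.id, dite_true]
    exact idCast_comp _ _ _ _ _ HEq.rfl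
  · intro l _ hl
    simp [Family.id, hl]

theorem Family.comp_id {X Y : ℤ → A.Obj} {p : ℤ} (f : A.Family X Y p) :
    Family.comp (zero_add p) f (Family.id X) = f := by
  ext i j
  rw [Family.comp_apply (zero_add p) _ _ i j _ (Finset.subset_insert i _),
    Finset.sum_eq_single_of_mem i (Finset.mem_insert_self _ _)]
  · simp only [Family.id, dite_true]
    exact comp_idCast _ _ _ _ _ HEq.rfl
  · intro l _ hl
    simp [Family.id, hl.symm]

end

theorem Family.diff_add {X Y : ℤ → A.Obj} {p q : ℤ} (h : p + 1 = q) (f g : A.Family X Y p) :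
    Family.diff h (f + g) = Family.diff h f + Family.diff h g := by
  ext i j
  simp [Family.diff]

theorem Family.diff_sub {X Y : ℤ → A.Obj} {p q : ℤ} (h : p + 1 = q) (f g : A.Family X Y p) :
    Family.diff h (f - g) = Family.diff h f - Family.diff h g := by
  ext i j
  simp [Family.diff, smul_sub]

theorem Family.diff_smul {X Y : ℤ → A.Obj} {p q : ℤ} (h : p + 1 = q) (c : k)
    (f : A.Family X Y p) : Family.diff h (c • f) = c • Family.diff h f := by
  ext i j
  simp only [Family.diff, Pi.smul_apply, map_smul, Units.smul_def]
  exact smul_comm _ _ _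

theorem Family.diff_units_smul {X Y : ℤ → A.Obj} {p q : ℤ} (h : p + 1 = q) (c : ℤˣ)
    (f : A.Family X Y p) : Family.diff h (c • f) = c • Family.diff h f := by
  ext i j
  simp only [Family.diff, Pi.smul_apply, map_zsmul, Units.smul_def]
  exact smul_comm _ _ _

theorem Family.diff_id (X : ℤ → A.Obj) : Family.diff (zero_add 1) (Family.id X) = 0 := by
  ext i j
  by_cases h : i = j
  · simp [Family.diff, Family.id, h, d_idCast]
  · simp [Family.diff, Family.id, h]

theorem Family.diff_diff {X Y : ℤ → A.Obj} {n m l : ℤ} (h : n + 1 = m) (h' : m + 1 = l)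
    (f : A.Family X Y n) : Family.diff h' (Family.diff h f) = 0 := by
  ext i j
  simp [Family.diff, Units.smul_def, A.d_d]

theorem Family.diff_comp [A.IsNonpositive] {X Y Z : ℤ → A.Obj} {p q r p' q' r' : ℤ}
    (h : p + q = r) (hp : p + 1 = p') (hq : q + 1 = q') (hr : r + 1 = r')
    (g : A.Family Y Z q) (f : A.Family X Y p) :
    Family.diff hr (Family.comp h g f) =
      Family.comp (show p + q' = r' by lia) (Family.diff hq g) f +
        q.negOnePow • Family.comp (show p' + q = r' by lia) g (Family.diff hp f) := by
  ext i j
  have hs₁ : Finset.Icc (i + p) (j - q') ⊆ Finset.Icc (i + p) (j - q) :=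
    Finset.Icc_subset_Icc le_rfl (by lia)
  have hs₂ : Finset.Icc (i + p') (j - q) ⊆ Finset.Icc (i + p) (j - q) :=
    Finset.Icc_subset_Icc (by lia) le_rfl
  simp only [Pi.add_apply, Pi.smul_apply, Family.diff, Family.comp_apply _ _ _ i j _ hs₁,
    Family.comp_apply _ _ _ i j _ hs₂, Family.comp_apply h _ _ i j _ subset_rfl]
  rw [map_sum, Finset.smul_sum, Finset.smul_sum, ← Finset.sum_add_distrib]
  refine Finset.sum_congr rfl fun l _ => ?_
  rw [A.d_comp _ (show (i - l + p) + 1 = i - l + p' by lia)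
    (show (l - j + q) + 1 = l - j + q' by lia)]
  simp only [Units.smul_def, map_zsmul, LinearMap.smul_apply, smul_add, smul_smul]
  congr 2
  rw [← Units.val_mul, ← Units.val_mul, ← Int.negOnePow_add, ← Int.negOnePow_add]
  congr 1
  rw [Int.negOnePow_eq_iff]
  exact ⟨j - j, by lia⟩

variable (A) in
/-- A (one-sided, unbounded) twisted complex on `A`: objects `X^i`, and morphisms
`x_i^j : X^i → X^j` of degree `i - j + 1` (here `x i j`), such that
`(-1)^j d x_i^j + ∑_k x_k^j x_i^k = 0`. If `A` is strictly concentrated in nonpositive degrees, the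
sums have only finitely many nonzero terms. -/
structure TwistedComplex where
  X : ℤ → A.Obj
  x : ∀ i j : ℤ, A.Hom (X i) (X j) (i - j + 1)
  eq : ∀ i j : ℤ,
    j.negOnePow • A.d (show (i - j + 1) + 1 = i - j + 2 by lia) (x i j) +
      ∑ᶠ l : ℤ, A.comp (show (i - l + 1) + (l - j + 1) = i - j + 2 by lia) (x l j) (x i l) = 0

theorem TwistedComplex.diff_add_comp (X : A.TwistedComplex) :
    Family.diff (show (1 : ℤ) + 1 = 2 by lia) X.x + Family.comp (show (1 : ℤ) + 1 = 2 by lia) X.x X.x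
      = 0 := by
  ext i j
  exact X.eq i j

/-- The differential of a morphism `f : X → Y` of degree `n` of twisted complexes:
`(df)_i^j = (-1)^j d f_i^j + ∑_k (y_k^j f_i^k - (-1)^n f_k^j x_i^k)`. -/
noncomputable def twDiff {X Y : A.TwistedComplex} {n m : ℤ} (h : n + 1 = m)
    (f : A.Family X.X Y.X n) : A.Family X.X Y.X m :=
  fun i j =>
    j.negOnePow • A.d (show (i - j + n) + 1 = i - j + m by lia) (f i j) +
      ∑ᶠ l : ℤ,
        (A.comp (show (i - l + n) + (l - j + 1) = i - j + m by lia) (Y.x l j) (f i l) -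
          n.negOnePow • A.comp (show (i - l + 1) + (l - j + n) = i - j + m by lia) (f l j) (X.x i l))

section

variable [A.IsNonpositive]

theorem twDiff_eq {X Y : A.TwistedComplex} {n m : ℤ} (h : n + 1 = m) (f : A.Family X.X Y.X n) :
    twDiff h f = Family.diff h f + (Family.comp h Y.x f -
      n.negOnePow • Family.comp (show 1 + n = m by lia) f X.x) := by
  ext i j
  simp only [twDiff, Pi.add_apply, Pi.sub_apply, Pi.smul_apply, Family.diff]
  congr 1
  refine (finsum_sub_distrib (Family.finite_support h Y.x f i j)
    ((Family.finite_support (show 1 + n = m by lia) f X.x i j).subset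
      (Function.support_const_smul_subset n.negOnePow _))).trans ?_
  congr 1
  exact (smul_finsum' (n.negOnePow : ℤ)
    (Family.finite_support (show 1 + n = m by lia) f X.x i j)).symm

theorem twDiff_add {X Y : A.TwistedComplex} {n m : ℤ} (h : n + 1 = m) (f g : A.Family X.X Y.X n) :
    twDiff h (f + g) = twDiff h f + twDiff h g := by
  simp only [twDiff_eq, Family.comp_add, Family.add_comp, Family.diff_add, smul_add]
  abel

theorem twDiff_smul {X Y : A.TwistedComplex} {n m : ℤ} (h : n + 1 = m) (c : k)
    (f : A.Family X.X Y.X n) : twDiff h (c • f) = c • twDiff h f := by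
  simp only [twDiff_eq, Family.comp_smul, Family.smul_comp, Family.diff_smul, smul_add, smul_sub,
    Units.smul_def, smul_comm c]

theorem twDiff_id (X : A.TwistedComplex) : twDiff (zero_add 1) (Family.id X.X) = 0 := by
  rw [twDiff_eq, Family.diff_id, Family.comp_id, zero_add, Family.id_comp]
  simp

theorem twDiff_twDiff {X Y : A.TwistedComplex} {n m l : ℤ} (h : n + 1 = m) (h' : m + 1 = l)
    (f : A.Family X.X Y.X n) : twDiff h' (twDiff h f) = 0 := by
  have hm : m.negOnePow = -n.negOnePow := by rw [← h, Int.negOnePow_succ]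
  have hy : Family.comp (show n + 2 = l by lia)
      (Family.diff (show (1 : ℤ) + 1 = 2 by lia) Y.x) f +
        Family.comp h' Y.x (Family.comp h Y.x f) = 0 := by
    rw [← Family.assoc (show (1 : ℤ) + 1 = 2 by lia) (show n + 2 = l by lia) h h',
      ← Family.add_comp, Y.diff_add_comp, Family.zero_comp]
  have hx : Family.comp (show 2 + n = l by lia) f
      (Family.diff (show (1 : ℤ) + 1 = 2 by lia) X.x) +
        Family.comp (show 1 + m = l by lia) (Family.comp (show 1 + n = m by lia) f X.x) X.x = 0 := by
    rw [Family.assoc (show 1 + n = m by lia) (show 1 + m = l by lia) (show (1 : ℤ) + 1 = 2 by lia)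
      (show 2 + n = l by lia), ← Family.comp_add, X.diff_add_comp, Family.comp_zero]
  have hyx : Family.comp h' Y.x (Family.comp (show 1 + n = m by lia) f X.x) =
      Family.comp (show 1 + m = l by lia) (Family.comp h Y.x f) X.x :=
    (Family.assoc h (show 1 + m = l by lia) (show 1 + n = m by lia) h' Y.x f X.x).symm
  rw [add_comm] at hx
  have hx' := eq_neg_of_add_eq_zero_left hx
  rw [add_comm] at hy
  have hy' := eq_neg_of_add_eq_zero_left hy
  rw [twDiff_eq h', twDiff_eq h]
  simp only [Family.diff_add, Family.diff_sub, Family.diff_units_smul, Family.diff_diff,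
    Family.comp_add, Family.add_comp, Family.comp_sub, Family.sub_comp, Family.comp_units_smul,
    Family.units_smul_comp, hyx, hx', hy', hm,
    Family.diff_comp h h (show (1 : ℤ) + 1 = 2 by lia) h',
    Family.diff_comp (show 1 + n = m by lia) (show (1 : ℤ) + 1 = 2 by lia) h h']
  rcases Int.even_or_odd n with hn | hn
  · simp only [Int.negOnePow_even n hn, Int.negOnePow_one, Units.neg_smul, one_smul]
    abel
  · simp only [Int.negOnePow_odd n hn, Int.negOnePow_one, Units.neg_smul, one_smul]
    abel

theorem twDiff_comp {X Y Z : A.TwistedComplex} {p q r p' q' r' : ℤ} (h : p + q = r)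
    (hp : p + 1 = p') (hq : q + 1 = q') (hr : r + 1 = r') (g : A.Family Y.X Z.X q)
    (f : A.Family X.X Y.X p) :
    twDiff hr (Family.comp h g f) =
      Family.comp (show p + q' = r' by lia) (twDiff hq g) f +
        q.negOnePow • Family.comp (show p' + q = r' by lia) g (twDiff hp f) := by
  have e₁ : Family.comp hr Z.x (Family.comp h g f) =
      Family.comp (show p + q' = r' by lia) (Family.comp hq Z.x g) f :=
    (Family.assoc _ _ _ _ Z.x g f).symm
  have e₂ : Family.comp (show p + q' = r' by lia) (Family.comp (show 1 + q = q' by lia) g Y.x) f =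
      Family.comp (show p' + q = r' by lia) g (Family.comp hp Y.x f) :=
    Family.assoc _ _ _ _ g Y.x f
  have e₃ : Family.comp (show 1 + r = r' by lia) (Family.comp h g f) X.x =
      Family.comp (show p' + q = r' by lia) g (Family.comp (show 1 + p = p' by lia) f X.x) :=
    Family.assoc _ _ _ _ g f X.x
  have hs : r.negOnePow = q.negOnePow * p.negOnePow := by
    rw [← Int.negOnePow_add, add_comm q p, h]
  rw [twDiff_eq hr, twDiff_eq hp, twDiff_eq hq, Family.diff_comp h hp hq hr]
  simp only [Family.comp_add, Family.add_comp, Family.comp_sub, Family.sub_comp,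
    Family.comp_units_smul, Family.units_smul_comp, smul_add, smul_sub, smul_smul, e₁, e₂, e₃, hs]
  abel

variable (A) in
/-- The dg-category `Tw(A)` of twisted complexes on a dg-category `A` which is strictly concentrated
in nonpositive degrees. Morphisms of degree `p` are families `f_i^j : X^i → Y^j` of morphisms of
degree `i - j + p`, with `(g ∘ f)_i^j = ∑_k g_k^j f_i^k`. -/
noncomputable def twNonpos : DGCat.{w, max u v, v} k where
  Obj := A.TwistedComplex
  Hom X Y p := A.Family X.X Y.X p
  d h :=
    { toFun := twDiff h
      map_add' := twDiff_add h
      map_smul' := twDiff_smul h }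
  comp h := LinearMap.mk₂ k (Family.comp h) (Family.add_comp h) (fun c g f => Family.smul_comp h c g f)
    (Family.comp_add h) (fun c g f => Family.comp_smul h c g f)
  id X := Family.id X.X
  d_d h h' f := twDiff_twDiff h h' f
  d_id X := twDiff_id X
  d_comp h hp hq hr g f := twDiff_comp h hp hq hr g f
  id_comp f := Family.id_comp f
  comp_id f := Family.comp_id f
  assoc h₁ h₂ h₃ h₄ e g f := Family.assoc h₁ h₂ h₃ h₄ e g f

end

end Tw

section TwMap

variable {A : DGCat.{w, u, v} k} {B : DGCat.{w, u', v'} k}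

/-- `Tw(u)` on morphisms: `Tw(u)(f)_i^j = u(f_i^j)`. -/
def Family.map (F : DGFunctor A B) {X Y : ℤ → A.Obj} {n : ℤ} :
    A.Family X Y n →ₗ[k] B.Family (fun i => F.obj (X i)) (fun i => F.obj (Y i)) n where
  toFun f i j := F.map (f i j)
  map_add' f g := by ext i j; exact map_add _ _ _
  map_smul' c f := by ext i j; exact map_smul _ _ _

theorem Family.map_comp [A.IsNonpositive] (F : DGFunctor A B) {X Y Z : ℤ → A.Obj} {p q r : ℤ}
    (h : p + q = r) (g : A.Family Y Z q) (f : A.Family X Y p) :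
    Family.map F (Family.comp h g f) = Family.comp h (Family.map F g) (Family.map F f) := by
  ext i j
  refine (F.map.toAddMonoidHom.map_finsum (Family.finite_support h g f i j)).trans ?_
  simp only [LinearMap.toAddMonoidHom_coe, F.map_comp]
  rfl

theorem Family.map_diff (F : DGFunctor A B) {X Y : ℤ → A.Obj} {n m : ℤ} (h : n + 1 = m)
    (f : A.Family X Y n) : Family.map F (Family.diff h f) = Family.diff h (Family.map F f) := by
  ext i j
  change F.map (j.negOnePow • A.d _ (f i j)) = j.negOnePow • B.d _ (F.map (f i j))
  rw [Units.smul_def, map_zsmul, F.map_d, Units.smul_def]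

theorem map_idCast (F : DGFunctor A B) {X Y : A.Obj} {n : ℤ} (h : X = Y) (hn : 0 = n) :
    F.map (A.idCast h hn) = B.idCast (congrArg F.obj h) hn := by
  subst h; subst hn
  exact F.map_id X

theorem Family.map_id (F : DGFunctor A B) (X : ℤ → A.Obj) :
    Family.map F (Family.id X) = Family.id fun i => F.obj (X i) := by
  ext i j
  change F.map (Family.id X i j) = _
  by_cases h : i = j
  · simp only [Family.id, h, dite_true]
    exact map_idCast F _ _
  · simp [Family.id, h]

/-- `Tw(u)` on objects: `Tw(u)(X^i, x_i^j) = (u(X^i), u(x_i^j))`. -/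
def TwistedComplex.map [A.IsNonpositive] (F : DGFunctor A B) (X : A.TwistedComplex) :
    B.TwistedComplex where
  X i := F.obj (X.X i)
  x i j := F.map (X.x i j)
  eq i j := by
    have := congrArg (Family.map F) X.diff_add_comp
    rw [map_add, Family.map_diff, Family.map_comp, map_zero] at this
    exact congrFun (congrFun this i) j

theorem Family.map_twDiff [A.IsNonpositive] [B.IsNonpositive] (F : DGFunctor A B)
    {X Y : A.TwistedComplex} {n m : ℤ} (h : n + 1 = m) (f : A.Family X.X Y.X n) :
    Family.map F (twDiff h f) = twDiff (X := X.map F) (Y := Y.map F) h (Family.map F f) := by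
  refine Eq.trans ?_ (twDiff_eq (X := X.map F) (Y := Y.map F) h (Family.map F f)).symm
  rw [twDiff_eq, map_add, map_sub, Units.smul_def, map_zsmul, Family.map_diff,
    Family.map_comp, Family.map_comp]
  rfl

/-- The dg-functor `Tw(u) : Tw(A) → Tw(B)` for dg-categories strictly concentrated in nonpositive
degrees. -/
noncomputable def twNonposMap [A.IsNonpositive] [B.IsNonpositive] (F : DGFunctor A B) :
    DGFunctor A.twNonpos B.twNonpos where
  obj X := X.map F
  map {X Y n} := Family.map F (X := X.X) (Y := Y.X) (n := n)
  map_d h f := Family.map_twDiff F h f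
  map_comp h g f := Family.map_comp F h g f
  map_id X := Family.map_id F X.X

end TwMap

/-- `Tw(A) = Tw(τ_{≤ 0} A_{0})`, for an arbitrary dg-category `A`. -/
noncomputable def tw (A : DGCat.{w, u, v} k) : DGCat.{w, max u v, v} k :=
  A.addZero.trunc.twNonpos

/-- `Tw(u) = Tw(τ_{≤ 0} u_{0})`, for an arbitrary dg-functor `u`. -/
noncomputable def twMap {A : DGCat.{w, u, v} k} {B : DGCat.{w, u', v'} k} (F : DGFunctor A B) :
    DGFunctor A.tw B.tw :=
  twNonposMap (truncMap (addZeroMap F))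

theorem dgFunctor_ext {A : DGCat.{w, u, v} k} {B : DGCat.{w, u', v'} k} {F G : DGFunctor A B}
    (hobj : ∀ X, F.obj X = G.obj X)
    (hmap : ∀ (X Y : A.Obj) (n : ℤ) (f : A.Hom X Y n), HEq (F.map f) (G.map f)) : F = G := by
  obtain ⟨Fo, Fm, _, _, _⟩ := F
  obtain ⟨Go, Gm, _, _, _⟩ := G
  obtain rfl : Fo = Go := funext hobj
  have : @Fm = @Gm := by
    funext X Y n
    exact LinearMap.ext fun f => eq_of_heq (hmap X Y n f)
  subst this
  rfl

theorem addZeroMap_id (A : DGCat.{w, u, v} k) : addZeroMap (𝟙 A) = 𝟙 A.addZero := by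
  refine dgFunctor_ext ?_ ?_
  · rintro (_ | X) <;> rfl
  · rintro (_ | X) (_ | Y) n f
    · exact heq_of_eq (addZero_ext_left _ _)
    · exact heq_of_eq (addZero_ext_left _ _)
    · exact heq_of_eq (addZero_ext_right _ _)
    · rfl

theorem addZeroMap_comp {A B C : DGCat.{w, u, v} k} (F : A ⟶ B) (G : B ⟶ C) :
    addZeroMap (F ≫ G) =
      (show A.addZero ⟶ B.addZero from addZeroMap F) ≫
        (show B.addZero ⟶ C.addZero from addZeroMap G) := by
  refine dgFunctor_ext ?_ ?_
  · rintro (_ | X) <;> rfl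
  · rintro (_ | X) (_ | Y) n f
    · exact heq_of_eq (addZero_ext_left _ _)
    · exact heq_of_eq (addZero_ext_left _ _)
    · exact heq_of_eq (addZero_ext_right _ _)
    · rfl

/-- `Tw` as a functor between categories of dg-categories. -/
noncomputable def twFunctor : DGCat.{w, u, v} k ⥤ DGCat.{w, max u v, v} k where
  obj A := A.tw
  map F := twMap F
  map_id A := by
    change twNonposMap (truncMap (addZeroMap (𝟙 A))) = _
    rw [addZeroMap_id]
    rfl
  map_comp F G := by
    change twNonposMap (truncMap (addZeroMap (F ≫ G))) = _
    rw [addZeroMap_comp]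
    rfl

/-! ### Quasi-equivalence classes and the homotopy category of dg-categories -/

variable (k) in
/-- The class of quasi-equivalences. -/
def quasiEquivalences : MorphismProperty (DGCat.{w, u, v} k) := fun _ _ F => F.IsQuasiEquivalence

/-- Two dg-categories are quasi-equivalent if they are joined by a finite zigzag of
quasi-equivalences. -/
def QuasiEquivalent (A B : DGCat.{w, u, v} k) : Prop :=
  Relation.EqvGen (fun A B : DGCat.{w, u, v} k => ∃ F : A ⟶ B, quasiEquivalences k F) A B

variable (k) in
/-- The homotopy category of dg-categories, obtained by formally inverting quasi-equivalences. -/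
abbrev Hqe := (quasiEquivalences.{w, u, v} k).Localization

/-- The localization functor from dg-categories to `Hqe`. -/
abbrev toHqe : DGCat.{w, u, v} k ⥤ Hqe.{w, u, v} k := (quasiEquivalences.{w, u, v} k).Q

end DGCat

/-! ### Quasi-isomorphisms given by postcomposition -/

namespace DGFunctor

variable {k : Type w} [CommRing k] {A : DGCat.{w, u, v} k} {B : DGCat.{w, u', v'} k}

/-! The argument is a complete filtration argument, carried out by hand as successive approximation.
Filter families `f` by the condition `f_i^j = 0` for `j - i < m`. Over a dg-category in nonpositive
degrees, a family of degree `p` automatically has level `p`. The structure maps of a twisted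
complex, having degree one, therefore raise the level by at least one. On graded pieces the twisted
differential is thus only `±d`, and composing with a closed morphism `f` of degree zero is composing
with its diagonal components `f_j^j`. The filtration is bounded below in each degree, separated and
complete, so if postcomposition with each `f_j^j` has acyclic cone, then so has postcomposition with
`f`. This is `twNonposMap_postcompQuasiIso`, with approximations assembled by `exists_of_approx`.
For `f` the identity it says that `Tw(u)` is quasi-fully faithful.

For essential surjectivity, let `Y` be a twisted complex over `B` and choose `X^j` with closed
homotopy equivalences `φ_j : u(X^j) → Y^j`. The structure maps `x` on `X` and a closed morphism `f :
Tw(u)(X) → Y` with diagonal `φ` are built simultaneously, level by level, in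
`exists_curvature_eq_zero`. The obstruction at each level consists of the Maurer–Cartan defect of
`x` and the failure of `f` to be closed. Together these form a cocycle in the cone of
postcomposition with `φ_j`, so they can be removed. The filtration theorem for the identity of `B`,
followed by a Yoneda argument, shows that `f` is a homotopy equivalence.

Adding a formal zero object and truncating preserve both properties, which gives arbitrary
dg-categories. The statements on zigzags and on `Hqe` are then formal. -/

/-- This removes quotients and fixed successor degrees: `l`, `n`, `m` are free up to equations, so
the criterion applies to degrees such as `i - j + n` without casts. -/
theorem quasiFullyFaithful_iff (F : DGFunctor A B) :
    F.QuasiFullyFaithful ↔ ∀ (X Y : A.Obj) {l n m : ℤ} (hl : l + 1 = n) (hm : n + 1 = m),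
      (∀ c : A.Hom X Y n, A.d hm c = 0 → (∃ b, B.d hl b = F.map c) → ∃ a, A.d hl a = c) ∧
      ∀ b : B.Hom (F.obj X) (F.obj Y) n, B.d hm b = 0 →
        ∃ a e, A.d hm a = 0 ∧ F.map a - b = B.d hl e := by
  constructor
  · intro h X Y l n m hl hm
    obtain rfl : l = n - 1 := by lia
    subst hm
    refine ⟨fun c hc ⟨b, hb⟩ => ?_, fun b hb => ?_⟩
    · have h0 : F.cohomologyMap X Y n (Submodule.Quotient.mk ⟨c, hc⟩) = 0 :=
        (Submodule.Quotient.mk_eq_zero _).2 ⟨b, hb⟩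
      rw [← map_zero (F.cohomologyMap X Y n)] at h0
      obtain ⟨a, ha⟩ := (Submodule.Quotient.mk_eq_zero _).1 ((h X Y n).1 h0)
      exact ⟨a, ha⟩
    · obtain ⟨a, ha⟩ := (h X Y n).2 (Submodule.Quotient.mk ⟨b, hb⟩)
      induction a using Submodule.Quotient.induction_on with
      | H a =>
      obtain ⟨e, he⟩ := (Submodule.Quotient.eq _).1 ha
      exact ⟨a.1, e, a.2, he.symm⟩
  · intro h X Y n
    obtain ⟨h₁, h₂⟩ := h X Y (sub_add_cancel n 1) (rfl : n + 1 = n + 1)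
    constructor
    · refine (injective_iff_map_eq_zero _).2 fun c hc => ?_
      induction c using Submodule.Quotient.induction_on with
      | H c =>
      obtain ⟨b, hb⟩ := (Submodule.Quotient.mk_eq_zero _).1 hc
      exact (Submodule.Quotient.mk_eq_zero _).2 (h₁ c.1 c.2 ⟨b, hb⟩)
    · intro b
      induction b using Submodule.Quotient.induction_on with
      | H b =>
      obtain ⟨a, e, ha, he⟩ := h₂ b.1 b.2
      exact ⟨Submodule.Quotient.mk ⟨a, ha⟩, (Submodule.Quotient.eq _).2 ⟨e, he.symm⟩⟩

/-- The maps `A(X, X') → B(F X, Y')`, `a ↦ φ ∘ F a`, are quasi-isomorphisms for all `X`, in the sense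
that their cones are acyclic. -/
def PostcompQuasiIso (F : DGFunctor A B) {X' : A.Obj} {Y' : B.Obj} {z : ℤ} (hz : z = 0)
    (φ : B.Hom (F.obj X') Y' z) : Prop :=
  ∀ (X : A.Obj) {l n m p : ℤ} (hl : l + 1 = n) (hm : n + 1 = m) (hp : m + 1 = p)
    (c : A.Hom X X' m) (b : B.Hom (F.obj X) Y' n), A.d hp c = 0 →
      B.comp (show m + z = m by lia) φ (F.map c) = B.d hm b →
        ∃ a e, A.d hm a = c ∧ B.comp (show n + z = n by lia) φ (F.map a) - b = B.d hl e

theorem d_comp_map (F : DGFunctor A B) {X X' : A.Obj} {Y' : B.Obj} {φ : B.Hom (F.obj X') Y' 0}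
    (hφ : B.d (zero_add 1) φ = 0) {n m : ℤ} (hm : n + 1 = m) (a : A.Hom X X' n) :
    B.d hm (B.comp (add_zero n) φ (F.map a)) = B.comp (add_zero m) φ (F.map (A.d hm a)) := by
  rw [B.d_comp _ hm (zero_add 1) hm, hφ, F.map_d]
  simp

/-- The usual fact that a chain map bijective on cohomology has acyclic cone. Injectivity gives a
primitive of `c`; its mismatch with `b` is a cocycle, which surjectivity lets one absorb by changing
the primitive. -/
theorem postcompQuasiIso_of_bijective (F : DGFunctor A B) {X' : A.Obj} {Y' : B.Obj}
    (φ : B.Hom (F.obj X') Y' 0) (hφ : B.d (zero_add 1) φ = 0)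
    (H : ∀ (X : A.Obj) {l n m : ℤ} (hl : l + 1 = n) (hm : n + 1 = m),
      (∀ c : A.Hom X X' n, A.d hm c = 0 →
        (∃ b, B.d hl b = B.comp (add_zero n) φ (F.map c)) → ∃ a, A.d hl a = c) ∧
      ∀ b : B.Hom (F.obj X) Y' n, B.d hm b = 0 →
        ∃ a e, A.d hm a = 0 ∧ B.comp (add_zero n) φ (F.map a) - b = B.d hl e) :
    F.PostcompQuasiIso rfl φ := by
  intro X l n m p hl hm hp c b hc hb
  obtain ⟨a, ha⟩ := (H X hm hp).1 c hc ⟨b, hb.symm⟩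
  obtain ⟨a', e, ha', he⟩ := (H X hl hm).2 (B.comp (add_zero n) φ (F.map a) - b) (by
    rw [map_sub, F.d_comp_map hφ, ha, ← hb, sub_self])
  refine ⟨a - a', -e, by rw [map_sub, ha, ha', sub_zero], ?_⟩
  rw [map_neg, ← he, map_sub, map_sub]
  abel

theorem QuasiFullyFaithful.postcompQuasiIso {F : DGFunctor A B} (hF : F.QuasiFullyFaithful)
    {X' : A.Obj} {Y' : B.Obj} {φ : B.Hom (F.obj X') Y' 0} {ψ : B.Hom Y' (F.obj X') 0}
    (hφ : B.d (zero_add 1) φ = 0) (hψ : B.d (zero_add 1) ψ = 0)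
    (hψφ : ∃ h, B.comp (add_zero 0) ψ φ - B.id _ = B.d (neg_add_cancel 1) h)
    (hφψ : ∃ h, B.comp (add_zero 0) φ ψ - B.id _ = B.d (neg_add_cancel 1) h) :
    F.PostcompQuasiIso rfl φ := by
  obtain ⟨h, hh⟩ := hψφ
  obtain ⟨h', hh'⟩ := hφψ
  -- A homotopy from `t ∘ s` to the identity acts by postcomposition as a homotopy, so on cocycles
  -- `t ∘ s` differs from the identity by an explicit boundary.
  have key : ∀ {U V W : B.Obj} {s : B.Hom V W 0} {t : B.Hom W V 0} {h : B.Hom V V (-1)}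
      (_ : B.comp (add_zero 0) t s - B.id _ = B.d (neg_add_cancel 1) h) {l n m : ℤ}
      (hl : l + 1 = n) (hm : n + 1 = m) (b : B.Hom U V n) (_ : B.d hm b = 0),
      B.comp (add_zero n) t (B.comp (add_zero n) s b) - b =
        B.d hl (B.comp (show n + -1 = l by lia) h b) := by
    intro U V W s t h hst l n m hl hm b hb
    rw [B.d_comp _ hm (neg_add_cancel 1) hl, hb, ← hst,
      ← B.assoc (add_zero 0) (add_zero n) (add_zero n) (add_zero n)]
    simp [B.id_comp]
  have hd : ∀ {U V W : B.Obj} {s : B.Hom V W 0} (_ : B.d (zero_add 1) s = 0) {n m : ℤ}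
      (hm : n + 1 = m) (b : B.Hom U V n),
      B.d hm (B.comp (add_zero n) s b) = B.comp (add_zero m) s (B.d hm b) := by
    intro U V W s hs n m hm b
    rw [B.d_comp _ hm (zero_add 1) hm, hs]
    simp
  refine F.postcompQuasiIso_of_bijective φ hφ fun X l n m hl hm => ⟨?_, ?_⟩
  · rintro c hc ⟨b, hb⟩
    have hFc : B.d hm (F.map c) = 0 := by rw [← F.map_d, hc, map_zero]
    -- From `φ ∘ F c = d b` one gets `F c = ψ ∘ φ ∘ F c - d (h ∘ F c) = d (ψ ∘ b - h ∘ F c)`.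
    refine ((F.quasiFullyFaithful_iff.1 hF X X' hl hm).1 c hc
      ⟨B.comp (add_zero l) ψ b - B.comp (show n + -1 = l by lia) h (F.map c), ?_⟩)
    rw [map_sub, ← key hh hl hm _ hFc, hd hψ, hb]
    abel
  · intro b hb
    obtain ⟨a, e, ha, he⟩ := (F.quasiFullyFaithful_iff.1 hF X X' hl hm).2
      (B.comp (add_zero n) ψ b) (by rw [hd hψ, hb, map_zero])
    refine ⟨a, B.comp (add_zero l) φ e + B.comp (show n + -1 = l by lia) h' b, ha, ?_⟩
    rw [map_add, ← key hh' hl hm b hb, hd hφ, ← he, map_sub]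
    abel

theorem QuasiFullyFaithful.postcompQuasiIso_id {F : DGFunctor A B} (hF : F.QuasiFullyFaithful)
    (X : A.Obj) : F.PostcompQuasiIso rfl (B.id (F.obj X)) :=
  hF.postcompQuasiIso (B.d_id _) (B.d_id _) ⟨0, by simp [B.id_comp]⟩ ⟨0, by simp [B.id_comp]⟩

theorem PostcompQuasiIso.exists_of_cycle {F : DGFunctor A B} {X' : A.Obj} {Y' : B.Obj} {z : ℤ}
    {hz : z = 0} {φ : B.Hom (F.obj X') Y' z} (h : F.PostcompQuasiIso hz φ) {X : A.Obj} {l n m : ℤ}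
    (hl : l + 1 = n) (hm : n + 1 = m) (b : B.Hom (F.obj X) Y' n) (hb : B.d hm b = 0) :
    ∃ a e, A.d hm a = 0 ∧ B.comp (show n + z = n by lia) φ (F.map a) - b = B.d hl e :=
  h X hl hm rfl 0 b (map_zero _) (by rw [map_zero, map_zero, hb])

theorem quasiFullyFaithful_of_postcompQuasiIso_id {F : DGFunctor A B}
    (hF : ∀ X : A.Obj, F.PostcompQuasiIso rfl (B.id (F.obj X))) : F.QuasiFullyFaithful := by
  refine F.quasiFullyFaithful_iff.2 fun X Y l n m hl hm => ⟨?_, ?_⟩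
  · rintro c hc ⟨b, hb⟩
    obtain ⟨a, -, ha, -⟩ := hF Y X (sub_add_cancel l 1) hl hm c b hc (by rw [hb, B.id_comp])
    exact ⟨a, ha⟩
  · intro b hb
    simpa only [B.id_comp] using (hF Y).exists_of_cycle hl hm b hb

theorem quasiFullyFaithful_id (A : DGCat.{w, u, v} k) :
    DGFunctor.QuasiFullyFaithful (𝟙 A : A ⟶ A) :=
  (quasiFullyFaithful_iff _).2 fun _ _ _ _ _ _ _ =>
    ⟨fun _ _ h => h, fun b hb => ⟨b, 0, hb, by rw [map_zero]; exact sub_self b⟩⟩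

end DGFunctor

/-! ### Isomorphisms in the homotopy category -/

namespace DGCat

variable {k : Type w} [CommRing k] {A : DGCat.{w, u, v} k}

theorem nonempty_iso_H0_iff (X Y : A.Obj) :
    Nonempty ((⟨X⟩ : A.H0) ≅ ⟨Y⟩) ↔ ∃ (f : A.Hom X Y 0) (g : A.Hom Y X 0),
      A.d (zero_add 1) f = 0 ∧ A.d (zero_add 1) g = 0 ∧
      (∃ h, A.comp (add_zero 0) g f - A.id X = A.d (neg_add_cancel 1) h) ∧
      ∃ h, A.comp (add_zero 0) f g - A.id Y = A.d (neg_add_cancel 1) h := by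
  constructor
  · rintro ⟨⟨f, g, hfg, hgf⟩⟩
    change A.cohomology X Y 0 at f
    change A.cohomology Y X 0 at g
    induction f using Submodule.Quotient.induction_on with
    | H f =>
    induction g using Submodule.Quotient.induction_on with
    | H g =>
    obtain ⟨h, hh⟩ := (Submodule.Quotient.eq _).1 hfg
    obtain ⟨h', hh'⟩ := (Submodule.Quotient.eq _).1 hgf
    exact ⟨f.1, g.1, f.2, g.2, ⟨h, hh.symm⟩, ⟨h', hh'.symm⟩⟩
  · rintro ⟨f, g, hf, hg, ⟨h, hh⟩, ⟨h', hh'⟩⟩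
    exact ⟨⟨(Submodule.Quotient.mk ⟨f, hf⟩ : A.cohomology X Y 0),
      (Submodule.Quotient.mk ⟨g, hg⟩ : A.cohomology Y X 0),
      (Submodule.Quotient.eq _).2 ⟨h, hh.symm⟩, (Submodule.Quotient.eq _).2 ⟨h', hh'.symm⟩⟩⟩

theorem _root_.DGFunctor.mapH0_essSurj_iff {B : DGCat.{w, u', v'} k} (F : DGFunctor A B) :
    F.mapH0.EssSurj ↔ ∀ Y : B.Obj, ∃ X : A.Obj, Nonempty ((⟨F.obj X⟩ : B.H0) ≅ ⟨Y⟩) :=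
  ⟨fun h Y => ⟨(h.mem_essImage ⟨Y⟩).choose.of, (h.mem_essImage ⟨Y⟩).choose_spec⟩,
    fun h => ⟨fun Y => ⟨⟨(h Y.of).choose⟩, (h Y.of).choose_spec⟩⟩⟩

/-- A Yoneda argument: lifting the identity of `Y` along `f ∘ -` gives a homotopy right inverse, and
injectivity of `f ∘ -` on cohomology makes it a left inverse too. -/
theorem nonempty_iso_H0_of_postcompQuasiIso {X Y : A.Obj} (f : A.Hom X Y 0)
    (hf : A.d (zero_add 1) f = 0)
    (H : DGFunctor.PostcompQuasiIso (𝟙 A : A ⟶ A) (X' := X) rfl f) :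
    Nonempty ((⟨X⟩ : A.H0) ≅ ⟨Y⟩) := by
  obtain ⟨g, e, hg, he⟩ := H.exists_of_cycle (neg_add_cancel 1) (zero_add 1) (X := Y) (A.id Y)
    (A.d_id Y)
  change A.comp _ f g - A.id Y = A.d _ e at he
  -- The cone cocycle used is `(g ∘ f - 1, e ∘ f)`: indeed `f ∘ (g ∘ f - 1) = (f ∘ g - 1) ∘ f = d (e
  -- ∘ f)`.
  obtain ⟨h, -, hh, -⟩ := H X (n := -1) (sub_add_cancel _ 1) (neg_add_cancel 1) (zero_add 1)
    (A.comp (add_zero 0) g f - A.id X) (A.comp (show 0 + -1 = -1 by lia) e f) (by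
      rw [map_sub, A.d_id, A.d_comp _ (zero_add 1) (zero_add 1), hf, hg]
      simp) (by
      change A.comp _ f (A.comp _ g f - A.id X) = _
      rw [A.d_comp _ (zero_add 1) (neg_add_cancel 1), hf, ← he, map_sub,
        ← A.assoc (add_zero 0) (add_zero 0) (add_zero 0) (add_zero 0)]
      simp only [map_sub, LinearMap.sub_apply, A.comp_id, map_zero,
        smul_zero, add_zero]
      exact congrArg _ (A.id_comp f).symm)
  exact (nonempty_iso_H0_iff X Y).2 ⟨f, g, hf, hg, ⟨h, hh.symm⟩, ⟨e, he⟩⟩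

end DGCat

/-! ### The filtration of families by `j - i` -/

namespace DGCat

variable {k : Type w} [CommRing k] {A : DGCat.{w, u, v} k} {B : DGCat.{w, u', v'} k}

/-- The families `f` with `f_i^j = 0` for `j - i < m`. -/
def Family.level (X Y : ℤ → A.Obj) (p m : ℤ) : AddSubgroup (A.Family X Y p) where
  carrier := {f | ∀ i j, j - i < m → f i j = 0}
  add_mem' hf hg i j h := by rw [Pi.add_apply, Pi.add_apply, hf i j h, hg i j h, add_zero]
  zero_mem' _ _ _ := rfl
  neg_mem' hf i j h := by rw [Pi.neg_apply, Pi.neg_apply, hf i j h, neg_zero]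

namespace Family

variable {X Y Z : ℤ → A.Obj} {p q r m m' : ℤ}

theorem level_anti (h : m' ≤ m) : level X Y p m ≤ level X Y p m' :=
  fun _ hf i j hij => hf i j (by lia)

theorem units_smul_mem_level (c : ℤˣ) {f : A.Family X Y p} (hf : f ∈ level X Y p m) :
    c • f ∈ level X Y p m :=
  fun i j h => by rw [Pi.smul_apply, Pi.smul_apply, hf i j h, smul_zero]

theorem diff_mem_level (h : p + 1 = q) {f : A.Family X Y p} (hf : f ∈ level X Y p m) :
    diff h f ∈ level X Y q m :=
  fun i j hij => by rw [diff, hf i j hij, map_zero, smul_zero]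

theorem map_mem_level (F : DGFunctor A B) {f : A.Family X Y p} (hf : f ∈ level X Y p m) :
    Family.map F f ∈ level (fun i => F.obj (X i)) (fun i => F.obj (Y i)) p m :=
  fun i j hij => (congrArg F.map (hf i j hij)).trans (map_zero _)

/-- The only input from nonpositivity to the filtration: the component `f_i^j` has degree `i - j +
p`, positive when `j - i < p`. It provides the starting level of every approximation. -/
theorem mem_level [A.IsNonpositive] (f : A.Family X Y p) : f ∈ level X Y p p :=
  fun i j h => IsNonpositive.eq_zero (by lia) _

theorem comp_mem_level (h : p + q = r) {s : ℤ} (hs : m + m' = s) {g : A.Family Y Z q}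
    {f : A.Family X Y p} (hg : g ∈ level Y Z q m') (hf : f ∈ level X Y p m) :
    comp h g f ∈ level X Z r s := by
  intro i j hij
  refine finsum_eq_zero_of_forall_eq_zero fun l => ?_
  rcases lt_or_ge (l - i) m with hl | hl
  · rw [hf i l hl, map_zero]
  · rw [hg l j (by lia), map_zero, LinearMap.zero_apply]

/-- On the graded pieces of the filtration, composition with a family of degree zero is
composition with its diagonal components. -/
theorem comp_apply_of_mem_level [A.IsNonpositive] (hq : q = 0) (h : p + q = r)
    (g : A.Family Y Z q) {f : A.Family X Y p} (hf : f ∈ level X Y p m) {i j : ℤ} (hij : j - i = m) :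
    comp h g f i j = A.comp (by lia) (g j j) (f i j) := by
  -- Terms with `l < j` vanish by the level of `f`, those with `l > j` because `g` has degree zero.
  refine finsum_eq_single _ j fun l hl => ?_
  rcases lt_or_gt_of_ne hl with hl | hl
  · rw [hf i l (by lia), map_zero]
  · rw [g.mem_level l j (by lia), map_zero, LinearMap.zero_apply]

/-- The structure maps have level one, so the twisting terms strictly raise the level; on graded
pieces only the internal differential survives. -/
theorem twDiff_sub_diff_mem_level [A.IsNonpositive] {X Y : A.TwistedComplex} {n m s : ℤ}
    (h : n + 1 = m) {f : A.Family X.X Y.X n} (hf : f ∈ level X.X Y.X n s) :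
    twDiff h f - diff h f ∈ level X.X Y.X m (s + 1) := by
  rw [twDiff_eq, add_sub_cancel_left]
  exact sub_mem (comp_mem_level h rfl (mem_level Y.x) hf)
    (units_smul_mem_level _ (comp_mem_level _ (add_comm 1 s) hf (mem_level X.x)))

theorem twDiff_mem_level [A.IsNonpositive] {X Y : A.TwistedComplex} {n m s : ℤ}
    (h : n + 1 = m) {f : A.Family X.X Y.X n} (hf : f ∈ level X.X Y.X n s) :
    twDiff h f ∈ level X.X Y.X m s := by
  have := add_mem (level_anti (by lia) (twDiff_sub_diff_mem_level h hf)) (diff_mem_level h hf)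
  rwa [sub_add_cancel] at this

theorem twDiff_apply_of_mem_level [A.IsNonpositive] {X Y : A.TwistedComplex} {n m s : ℤ}
    (h : n + 1 = m) {f : A.Family X.X Y.X n} (hf : f ∈ level X.X Y.X n s) {i j : ℤ}
    (hij : j - i = s) :
    twDiff h f i j = j.negOnePow • A.d (show (i - j + n) + 1 = i - j + m by lia) (f i j) :=
  sub_eq_zero.1 (twDiff_sub_diff_mem_level h hf i j (by lia))

theorem mem_level_succ {f : A.Family X Y p} (hf : f ∈ level X Y p m)
    (h : ∀ i j, j - i = m → f i j = 0) : f ∈ level X Y p (m + 1) := fun i j hij => by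
  rcases (show j - i ≤ m by lia).lt_or_eq with h' | h'
  exacts [hf i j h', h i j h']

theorem eq_zero_of_mem_level (m₀ : ℤ) {f : A.Family X Y p} (h : ∀ m ≥ m₀, f ∈ level X Y p m) :
    f = 0 := by
  ext i j
  exact h (max m₀ (j - i + 1)) (le_max_left _ _) i j (by lia)

end Family

/-- Construction of a family by successive approximation: the approximation of level `m + 1` may only
differ from that of level `m` in the components `(i, j)` with `m ≤ j - i`. -/
theorem exists_of_approx {T : ℤ → ℤ → Type*} (m₀ : ℤ) (P : ℤ → (∀ i j, T i j) → Prop)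
    (hP : ∀ m ≥ m₀, ∀ s s' : ∀ i j, T i j, (∀ i j, j - i < m → s i j = s' i j) → P m s → P m s')
    (s₀ : ∀ i j, T i j) (h₀ : P m₀ s₀)
    (step : ∀ m ≥ m₀, ∀ s, P m s → ∃ s', (∀ i j, j - i < m → s i j = s' i j) ∧ P (m + 1) s') :
    ∃ s, ∀ m ≥ m₀, P m s := by
  choose! next hnext hPnext using step
  let seq : ℕ → ∀ i j, T i j := fun n => Nat.rec s₀ (fun n s => next (m₀ + n) s) n
  have hseq : ∀ n : ℕ, P (m₀ + n) (seq n) := by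
    intro n
    induction n with
    | zero =>
      change P (m₀ + (0 : ℕ)) s₀
      rwa [Nat.cast_zero, add_zero]
    | succ n ih =>
      have := hPnext (m₀ + n) (by lia) _ ih
      rw [add_assoc] at this
      exact_mod_cast this
  have hstab : ∀ n d : ℕ, ∀ i j, j - i < m₀ + n → seq n i j = seq (n + d) i j := by
    intro n d i j hij
    induction d with
    | zero => rfl
    | succ d ih =>
      rw [ih]
      exact hnext (m₀ + (n + d : ℕ)) (by lia) _ (hseq _) i j (by push_cast; lia)
  -- Component `(i, j)` is read off at the first stage whose level exceeds `j - i`; later stages no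
  -- longer change it.
  refine ⟨fun i j => seq (j - i + 1 - m₀).toNat i j, fun m hm => ?_⟩
  obtain ⟨n, rfl⟩ : ∃ n : ℕ, m = m₀ + n := ⟨(m - m₀).toNat, by lia⟩
  refine hP _ hm _ _ (fun i j hij => ?_) (hseq n)
  obtain ⟨d, hd⟩ : ∃ d, n = (j - i + 1 - m₀).toNat + d := Nat.exists_eq_add_of_le (by lia)
  rw [hd]
  exact (hstab _ d i j (by lia)).symm

end DGCat

namespace DGCat

variable {k : Type w} [CommRing k] {A : DGCat.{w, u, v} k} {B : DGCat.{w, u', v'} k}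

/-! ### Quasi-isomorphisms of complexes of morphisms of twisted complexes -/

/-- Replacing `c` by `s • c` absorbs the sign `(-1)^j` of the differential of families. The minus
signs in the conclusion make `a` and `e` corrections that cancel a given residual. -/
theorem _root_.DGFunctor.PostcompQuasiIso.exists_units_smul {F : DGFunctor A B} {X' : A.Obj}
    {Y' : B.Obj} {z : ℤ} {hz : z = 0} {φ : B.Hom (F.obj X') Y' z} (H : F.PostcompQuasiIso hz φ)
    {X : A.Obj} {l n m p : ℤ} (hl : l + 1 = n) (hm : n + 1 = m) (hp : m + 1 = p) (s : ℤˣ)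
    (c : A.Hom X X' m) (b : B.Hom (F.obj X) Y' n) (hc : s • A.d hp c = 0)
    (hb : s • B.d hm b = B.comp (show m + z = m by lia) φ (F.map c)) :
    ∃ a e, s • A.d hm a = -c ∧
      B.comp (show n + z = n by lia) φ (F.map a) - s • B.d hl e = -b := by
  obtain ⟨α, ε, hα, hε⟩ := H X hl hm hp (s • c) b
    (by rw [Units.smul_def, map_zsmul, ← Units.smul_def]; exact hc)
    (by rw [Units.smul_def, map_zsmul, map_zsmul, ← Units.smul_def, ← hb, smul_smul,
      Int.units_mul_self, one_smul])
  refine ⟨-α, -(s • ε), ?_, ?_⟩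
  · rw [map_neg, hα, smul_neg, smul_smul, Int.units_mul_self, one_smul]
  · rw [map_neg, map_neg, map_neg, Units.smul_def, Units.smul_def, map_zsmul, ← Units.smul_def,
      ← Units.smul_def, smul_neg, smul_smul, Int.units_mul_self, one_smul, ← hε]
    abel

theorem twDiff_sub [A.IsNonpositive] {X Y : A.TwistedComplex} {n m : ℤ} (h : n + 1 = m)
    (f g : A.Family X.X Y.X n) : twDiff h (f - g) = twDiff h f - twDiff h g :=
  map_sub (AddMonoidHom.mk' (twDiff h) (twDiff_add h)) f g

/-- `Tw(u)` on morphisms of twisted complexes. -/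
def TwistedComplex.mapHom [A.IsNonpositive] (F : DGFunctor A B) (X Y : A.TwistedComplex) (n : ℤ) :
    A.Family X.X Y.X n →ₗ[k] B.Family (X.map F).X (Y.map F).X n :=
  Family.map F

theorem TwistedComplex.mapHom_mem_level [A.IsNonpositive] (F : DGFunctor A B)
    (X Y : A.TwistedComplex) {n m : ℤ} {a : A.Family X.X Y.X n} (ha : a ∈ Family.level X.X Y.X n m) :
    TwistedComplex.mapHom F X Y n a ∈ Family.level (X.map F).X (Y.map F).X n m :=
  Family.map_mem_level F ha

variable [A.IsNonpositive] [B.IsNonpositive]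

theorem TwistedComplex.mapHom_twDiff (F : DGFunctor A B) (X Y : A.TwistedComplex) {n m : ℤ}
    (h : n + 1 = m) (a : A.Family X.X Y.X n) :
    TwistedComplex.mapHom F X Y m (twDiff h a) = twDiff h (TwistedComplex.mapHom F X Y n a) :=
  Family.map_twDiff F h a

theorem twDiff_comp_map (F : DGFunctor A B) {X X' : A.TwistedComplex} {Y' : B.TwistedComplex}
    {f : B.Family (X'.map F).X Y'.X 0}
    (hf : twDiff (X := X'.map F) (Y := Y') (zero_add 1) f = 0) {n m : ℤ} (h : n + 1 = m)
    (a : A.Family X.X X'.X n) :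
    twDiff (X := X.map F) (Y := Y') h (Family.comp (add_zero n) f (TwistedComplex.mapHom F X X' n a)) =
      Family.comp (add_zero m) f (TwistedComplex.mapHom F X X' m (twDiff h a)) := by
  rw [twDiff_comp (X := X.map F) (Y := X'.map F) (Z := Y') (add_zero n) h (zero_add 1) h, hf,
    Family.zero_comp, ← TwistedComplex.mapHom_twDiff, Int.negOnePow_zero, one_smul, zero_add]

/-- A closed morphism of degree zero of twisted complexes, whose diagonal components induce
quasi-isomorphisms by postcomposition, induces quasi-isomorphisms by postcomposition. -/
theorem twNonposMap_postcompQuasiIso (F : DGFunctor A B) {X' : A.TwistedComplex}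
    {Y' : B.TwistedComplex} (f : B.Family (X'.map F).X Y'.X 0)
    (hf : twDiff (X := X'.map F) (Y := Y') (zero_add 1) f = 0)
    (H : ∀ j, F.PostcompQuasiIso (show j - j + 0 = 0 by lia) (f j j)) :
    (twNonposMap F).PostcompQuasiIso (X' := X') (Y' := Y') rfl f := by
  intro (X : A.TwistedComplex) l n m p hl hm hp c b hc hb
  change A.Family X.X X'.X m at c
  change B.Family (X.map F).X Y'.X n at b
  change twDiff hp c = 0 at hc
  change Family.comp (add_zero m) f (TwistedComplex.mapHom F X X' m c) =
    twDiff (X := X.map F) (Y := Y') hm b at hb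
  -- The pair approximates a solution of the two cone equations; `P r` says that both residuals have
  -- level `r`. Solving for both components at once is what keeps the induction going.
  let P : ℤ → (∀ i j, A.Hom (X.X i) (X'.X j) (i - j + n) ×
      B.Hom ((X.map F).X i) (Y'.X j) (i - j + l)) → Prop := fun r s =>
    twDiff hm (fun i j => (s i j).1) - c ∈ Family.level X.X X'.X m r ∧
    Family.comp (add_zero n) f (TwistedComplex.mapHom F X X' n (fun i j => (s i j).1)) - b -
      twDiff (X := X.map F) (Y := Y') hl (fun i j => (s i j).2) ∈
        Family.level (X.map F).X Y'.X n r
  suffices h : ∃ s, ∀ r ≥ n, P r s by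
    obtain ⟨s, hs⟩ := h
    refine ⟨(fun i j => (s i j).1 : A.Family X.X X'.X n),
        (fun i j => (s i j).2 : B.Family (X.map F).X Y'.X l), ?_, ?_⟩
    · have := sub_eq_zero.1 (Family.eq_zero_of_mem_level n fun r hr => (hs r hr).1)
      exact this
    · have := sub_eq_zero.1 (Family.eq_zero_of_mem_level n fun r hr => (hs r hr).2)
      exact this
  refine exists_of_approx n P ?_ (fun _ _ => 0) ?_ ?_
  · intro r _ s s' hss' ⟨h₁, h₂⟩
    have ha : (fun i j => (s' i j).1 : A.Family X.X X'.X n) - (fun i j => (s i j).1) ∈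
        Family.level X.X X'.X n r := fun i j hij => by
      simp [hss' i j hij]
    have he : (fun i j => (s' i j).2 : B.Family (X.map F).X Y'.X l) - (fun i j => (s i j).2) ∈
        Family.level (X.map F).X Y'.X l r := fun i j hij => by
      simp [hss' i j hij]
    constructor
    · have := add_mem (Family.twDiff_mem_level hm ha) h₁
      rwa [twDiff_sub, sub_add_sub_cancel] at this
    · have := add_mem (sub_mem (Family.comp_mem_level (add_zero n) (add_zero r)
        (Family.mem_level f) (TwistedComplex.mapHom_mem_level F X X' ha))
        (Family.twDiff_mem_level (X := X.map F) (Y := Y') hl he)) h₂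
      rw [twDiff_sub, map_sub, Family.comp_sub] at this
      convert this using 1
      abel
  -- The residuals have degrees `m = n + 1` and `n`, so at level `n` there is no condition yet.
  · exact ⟨Family.level_anti (by lia) (Family.mem_level _), Family.mem_level _⟩
  · rintro r - s ⟨h₁, h₂⟩
    set a : A.Family X.X X'.X n := fun i j => (s i j).1 with ha
    set e : B.Family (X.map F).X Y'.X l := fun i j => (s i j).2 with he
    set R := twDiff hm a - c with hR
    set S := Family.comp (add_zero n) f (TwistedComplex.mapHom F X X' n a) - b -
      twDiff (X := X.map F) (Y := Y') hl e with hS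
    -- The residual pair `(R, S)` is again a cocycle of the cone. Its components with `j - i = r`
    -- are then cocycles of the cones of the `f j j`, hence can be cancelled there.
    have hdR : twDiff hp R = 0 := by rw [hR, twDiff_sub, twDiff_twDiff, hc, sub_zero]
    have hdS : twDiff (X := X.map F) (Y := Y') hm S =
        Family.comp (add_zero m) f (TwistedComplex.mapHom F X X' m R) := by
      rw [hS, twDiff_sub, twDiff_sub, twDiff_comp_map F hf, twDiff_twDiff, ← hb, sub_zero, hR,
        map_sub, Family.comp_sub]
    have key : ∀ i j, ∃ (α : A.Hom (X.X i) (X'.X j) (i - j + n))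
        (ε : B.Hom ((X.map F).X i) (Y'.X j) (i - j + l)), (j - i < r → α = 0 ∧ ε = 0) ∧
        (j - i = r → j.negOnePow • A.d (show i - j + n + 1 = i - j + m by lia) α = -R i j ∧
          B.comp (X := (X.map F).X i) (Y := (X'.map F).X j)
            (show (i - j + n) + (j - j + 0) = i - j + n by lia) (f j j) (F.map α) -
            j.negOnePow • B.d (show i - j + l + 1 = i - j + n by lia) ε = -S i j) := by
      intro i j
      by_cases hij : j - i = r
      swap
      · exact ⟨0, 0, fun _ => ⟨rfl, rfl⟩, fun h => absurd h hij⟩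
      have hdR' := congrFun (congrFun hdR i) j
      rw [Family.twDiff_apply_of_mem_level hp h₁ hij] at hdR'
      have hdS' := congrFun (congrFun hdS i) j
      rw [Family.twDiff_apply_of_mem_level (X := X.map F) (Y := Y') hm h₂ hij,
        Family.comp_apply_of_mem_level rfl _ f (TwistedComplex.mapHom_mem_level F X X' h₁) hij] at hdS'
      obtain ⟨α, ε, hα, hε⟩ := (H j).exists_units_smul (X := X.X i)
        (show i - j + l + 1 = i - j + n by lia) (show i - j + n + 1 = i - j + m by lia)
        (show i - j + m + 1 = i - j + p by lia) j.negOnePow (R i j) (S i j) hdR' hdS'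
      exact ⟨α, ε, fun h => absurd hij h.ne, fun _ => ⟨hα, hε⟩⟩
    choose α ε h0 h1 using key
    have hα : α ∈ Family.level X.X X'.X n r := fun i j hij => (h0 i j hij).1
    have hε : ε ∈ Family.level (X.map F).X Y'.X l r := fun i j hij => (h0 i j hij).2
    refine ⟨fun i j => (a i j + α i j, e i j + ε i j), fun i j hij => ?_, ?_, ?_⟩
    · ext
      · simp [ha, (h0 i j hij).1]
      · simp [he, (h0 i j hij).2]
    · have : twDiff hm (a + α) - c = R + twDiff hm α := by rw [twDiff_add, hR]; abel
      change twDiff hm (a + α) - c ∈ _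
      rw [this]
      refine Family.mem_level_succ (add_mem h₁ (Family.twDiff_mem_level hm hα)) fun i j hij => ?_
      rw [Pi.add_apply, Pi.add_apply, Family.twDiff_apply_of_mem_level hm hα hij, (h1 i j hij).1,
        add_neg_cancel]
    · have : Family.comp (add_zero n) f (TwistedComplex.mapHom F X X' n (a + α)) - b -
          twDiff (X := X.map F) (Y := Y') hl (e + ε) =
          S + (Family.comp (add_zero n) f (TwistedComplex.mapHom F X X' n α) -
            twDiff (X := X.map F) (Y := Y') hl ε) := by
        rw [twDiff_add, map_add, Family.comp_add, hS]; abel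
      change Family.comp (add_zero n) f (TwistedComplex.mapHom F X X' n (a + α)) - b -
          twDiff (X := X.map F) (Y := Y') hl (e + ε) ∈ _
      rw [this]
      refine Family.mem_level_succ (add_mem h₂ (sub_mem
        (Family.comp_mem_level (add_zero n) (add_zero r) (Family.mem_level f)
          (TwistedComplex.mapHom_mem_level F X X' hα))
        (Family.twDiff_mem_level (X := X.map F) (Y := Y') hl hε))) fun i j hij => ?_
      rw [Pi.add_apply, Pi.add_apply, Pi.sub_apply, Pi.sub_apply,
        Family.twDiff_apply_of_mem_level (X := X.map F) (Y := Y') hl hε hij,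
        Family.comp_apply_of_mem_level rfl _ f (TwistedComplex.mapHom_mem_level F X X' hα) hij]
      refine (congrArg (S i j + ·) (h1 i j hij).2).trans (add_neg_cancel _)

end DGCat

namespace DGCat

variable {k : Type w} [CommRing k] {A : DGCat.{w, u, v} k} {B : DGCat.{w, u', v'} k}

/-! ### Lifting twisted complexes along quasi-isomorphisms -/

/-- The Maurer–Cartan defect `d x + x ∘ x` of a family of degree one. -/
noncomputable def Family.curvature {X : ℤ → A.Obj} (x : A.Family X X 1) : A.Family X X 2 :=
  Family.diff (show (1 : ℤ) + 1 = 2 by lia) x + Family.comp (show (1 : ℤ) + 1 = 2 by lia) x x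

/-- The defect `d f + y ∘ f - f ∘ x` of closedness of a family of degree zero. -/
noncomputable def Family.defect {X Y : ℤ → A.Obj} (x : A.Family X X 1) (y : A.Family Y Y 1)
    (f : A.Family X Y 0) : A.Family X Y 1 :=
  Family.diff (zero_add 1) f + Family.comp (zero_add 1) y f - Family.comp (add_zero 1) f x

/-! ### Bianchi identities and first-order variation of the curvature and the defect -/

namespace Family

theorem diff_neg {X Y : ℤ → A.Obj} {p q : ℤ} (h : p + 1 = q) (f : A.Family X Y p) :
    diff h (-f) = -diff h f := by
  ext i j
  simp [diff]

/-- The Bianchi identity: the cubic terms cancel by associativity. Since `x` has level one, the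
leading part of the curvature is a cocycle. -/
theorem diff_curvature [A.IsNonpositive] {X : ℤ → A.Obj} (x : A.Family X X 1) :
    diff (show (2 : ℤ) + 1 = 3 by lia) (curvature x) =
      comp (show (1 : ℤ) + 2 = 3 by lia) (curvature x) x -
        comp (show (2 : ℤ) + 1 = 3 by lia) x (curvature x) := by
  rw [curvature, diff_add, diff_diff, diff_comp (show (1 : ℤ) + 1 = 2 by lia)
    (show (1 : ℤ) + 1 = 2 by lia) (show (1 : ℤ) + 1 = 2 by lia), add_comp, comp_add,
    assoc (show (1 : ℤ) + 1 = 2 by lia) (show (1 : ℤ) + 2 = 3 by lia)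
      (show (1 : ℤ) + 1 = 2 by lia) (show (2 : ℤ) + 1 = 3 by lia), Int.negOnePow_one,
    Units.neg_smul, one_smul]
  abel

/-- The defect is the twisted differential of `f`, whose square is measured by curvature. To leading
order this is the second cocycle equation of the cone, for the pair formed by the curvature and
minus the defect. -/
theorem diff_defect [A.IsNonpositive] {X Y : ℤ → A.Obj} (x : A.Family X X 1) (y : A.Family Y Y 1)
    (f : A.Family X Y 0) (hy : curvature y = 0) :
    diff (show (1 : ℤ) + 1 = 2 by lia) (defect x y f) =
      -(comp (add_zero 2) f (curvature x) + comp (show (1 : ℤ) + 1 = 2 by lia) y (defect x y f) +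
        comp (show (1 : ℤ) + 1 = 2 by lia) (defect x y f) x) := by
  have e₁ : comp (show (1 : ℤ) + 1 = 2 by lia) y (comp (zero_add 1) y f) =
      -comp (zero_add 2) (diff (show (1 : ℤ) + 1 = 2 by lia) y) f := by
    rw [← assoc (show (1 : ℤ) + 1 = 2 by lia) (zero_add 2), eq_neg_iff_add_eq_zero, ← add_comp,
      add_comm]
    exact (congrArg (fun z => comp (zero_add 2) z f) hy).trans (zero_comp _ _)
  rw [defect, curvature, diff_sub, diff_add, diff_diff,
    diff_comp (zero_add 1) (zero_add 1) (show (1 : ℤ) + 1 = 2 by lia),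
    diff_comp (add_zero 1) (show (1 : ℤ) + 1 = 2 by lia) (zero_add 1)]
  simp only [add_comp, comp_add, sub_comp, comp_sub, e₁, Int.negOnePow_one, Int.negOnePow_zero,
    Units.neg_smul, one_smul]
  rw [assoc (zero_add 1) (show (1 : ℤ) + 1 = 2 by lia) (add_zero 1) (show (1 : ℤ) + 1 = 2 by lia),
    assoc (add_zero 1) (show (1 : ℤ) + 1 = 2 by lia) (show (1 : ℤ) + 1 = 2 by lia) (add_zero 2)]
  abel

theorem map_curvature [A.IsNonpositive] (F : DGFunctor A B) {X : ℤ → A.Obj} (x : A.Family X X 1) :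
    Family.map F (curvature x) = curvature (Family.map F x) := by
  rw [curvature, curvature, map_add, map_diff, map_comp]

/-- Every quadratic term involving `α` has a second factor of level one, so the leading variation is
linear and given by `diff` alone. -/
theorem curvature_add_sub_mem_level [A.IsNonpositive] {X : ℤ → A.Obj} (x : A.Family X X 1)
    {m : ℤ} {α : A.Family X X 1} (hα : α ∈ level X X 1 m) :
    curvature (x + α) - (curvature x + diff (show (1 : ℤ) + 1 = 2 by lia) α) ∈
      level X X 2 (m + 1) := by
  have : curvature (x + α) - (curvature x + diff (show (1 : ℤ) + 1 = 2 by lia) α) =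
      comp (show (1 : ℤ) + 1 = 2 by lia) x α + comp (show (1 : ℤ) + 1 = 2 by lia) α x +
        comp (show (1 : ℤ) + 1 = 2 by lia) α α := by
    rw [curvature, curvature, diff_add, add_comp, comp_add, comp_add]
    abel
  rw [this]
  exact add_mem (add_mem (comp_mem_level _ rfl (mem_level x) hα)
    (comp_mem_level _ (add_comm 1 m) hα (mem_level x)))
    (comp_mem_level _ (add_comm 1 m) hα (mem_level α))

theorem defect_add_sub_mem_level [A.IsNonpositive] {X Y : ℤ → A.Obj} (x : A.Family X X 1)
    (y : A.Family Y Y 1) (f : A.Family X Y 0) {m : ℤ} {α : A.Family X X 1} {ε : A.Family X Y 0}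
    (hε : ε ∈ level X Y 0 m) :
    defect (x + α) y (f + ε) -
      (defect x y f - (comp (add_zero 1) f α - diff (zero_add 1) ε)) ∈ level X Y 1 (m + 1) := by
  have : defect (x + α) y (f + ε) -
      (defect x y f - (comp (add_zero 1) f α - diff (zero_add 1) ε)) =
      comp (zero_add 1) y ε - comp (add_zero 1) ε (x + α) := by
    rw [defect, defect, diff_add, comp_add (zero_add 1), comp_add (add_zero 1),
      add_comp (add_zero 1), add_comp (add_zero 1), comp_add (add_zero 1)]
    abel
  rw [this]
  exact sub_mem (comp_mem_level _ rfl (mem_level y) hε)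
    (comp_mem_level _ (add_comm 1 m) hε (mem_level _))

theorem apply_eq_of_sub_mem_level {X Y : ℤ → A.Obj} {p m : ℤ} {f g : A.Family X Y p}
    (h : f - g ∈ level X Y p (m + 1)) {i j : ℤ} (hij : j - i = m) : f i j = g i j :=
  sub_eq_zero.1 (h i j (by lia))

theorem mem_level_of_sub_mem_level {X Y : ℤ → A.Obj} {p m : ℤ} {f g : A.Family X Y p}
    (h : f - g ∈ level X Y p (m + 1)) (hg : g ∈ level X Y p m) : f ∈ level X Y p m := by
  simpa using add_mem (level_anti (by lia) h) hg

end Family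

/-- Given quasi-isomorphisms `φ j : F (X j) → Y^j`, where `Y` is a twisted complex, there are
a structure of twisted complex on `X` and a closed morphism `F X → Y` with diagonal components the
`φ j`. -/
theorem exists_curvature_eq_zero [A.IsNonpositive] [B.IsNonpositive] (F : DGFunctor A B)
    (X : ℤ → A.Obj) (Y : B.TwistedComplex) (φ : B.Family (fun i => F.obj (X i)) Y.X 0)
    (H : ∀ j, F.PostcompQuasiIso (show j - j + 0 = 0 by lia) (φ j j)) :
    ∃ (x : A.Family X X 1) (f : B.Family (fun i => F.obj (X i)) Y.X 0),
      Family.curvature x = 0 ∧ Family.defect (Family.map F x) Y.x f = 0 ∧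
        ∀ j, f j j = φ j j := by
  have hY : Family.curvature (X := Y.X) Y.x = 0 := Y.diff_add_comp
  let P : ℤ → (∀ i j, A.Hom (X i) (X j) (i - j + 1) × B.Hom (F.obj (X i)) (Y.X j) (i - j + 0)) →
      Prop := fun r s =>
    Family.curvature (fun i j => (s i j).1) ∈ Family.level X X 2 r ∧
    Family.defect (Family.map F (fun i j => (s i j).1)) Y.x (fun i j => (s i j).2) ∈
      Family.level (fun i => F.obj (X i)) Y.X 1 r ∧
    ∀ j, (s j j).2 = φ j j
  suffices h : ∃ s, ∀ r ≥ 1, P r s by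
    obtain ⟨s, hs⟩ := h
    exact ⟨fun i j => (s i j).1, fun i j => (s i j).2,
      Family.eq_zero_of_mem_level 1 fun r hr => (hs r hr).1,
      Family.eq_zero_of_mem_level 1 fun r hr => (hs r hr).2.1, (hs 1 le_rfl).2.2⟩
  -- Used twice: for the independence of `P r` from components with `j - i ≥ r`, and to keep `P r`
  -- after a correction. The bound `1 ≤ r` leaves the diagonal of `f` untouched.
  have hadd : ∀ {r : ℤ}, 1 ≤ r → ∀ {x α : A.Family X X 1}
      {f ε : B.Family (fun i => F.obj (X i)) Y.X 0}, α ∈ Family.level X X 1 r →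
      ε ∈ Family.level (fun i => F.obj (X i)) Y.X 0 r →
      P r (fun i j => (x i j, f i j)) → P r (fun i j => ((x + α) i j, (f + ε) i j)) := by
    intro r hr x α f ε hα hε h
    refine ⟨Family.mem_level_of_sub_mem_level (Family.curvature_add_sub_mem_level x hα)
      (add_mem h.1 (Family.diff_mem_level _ hα)), ?_, fun j => ?_⟩
    · change Family.defect (Family.map F (x + α)) Y.x (f + ε) ∈ _
      rw [map_add]
      exact Family.mem_level_of_sub_mem_level
        (Family.defect_add_sub_mem_level _ _ _ hε)
        (sub_mem h.2.1 (sub_mem (Family.comp_mem_level _ (add_zero r) (Family.mem_level f)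
          (Family.map_mem_level F hα)) (Family.diff_mem_level _ hε)))
    · refine Eq.trans ?_ (h.2.2 j)
      change f j j + ε j j = f j j
      exact (congrArg (f j j + ·) (hε j j (by lia))).trans (add_zero _)
  -- With `x = 0` the curvature vanishes, and the defect has level one because it has degree one;
  -- the off-diagonal components of `φ` play no role.
  refine exists_of_approx 1 P ?_ (fun i j => (0, φ i j)) ?_ ?_
  · intro r hr s s' hss' h
    have hα : (fun i j => (s' i j).1 - (s i j).1) ∈ Family.level X X 1 r := fun i j hij => by
      simp [hss' i j hij]
    have hε : (fun i j => (s' i j).2 - (s i j).2) ∈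
        Family.level (fun i => F.obj (X i)) Y.X 0 r := fun i j hij => by
      simp [hss' i j hij]
    convert hadd hr (x := fun i j => (s i j).1) (f := fun i j => (s i j).2) hα hε h using 1
    funext i j
    simp
  · refine ⟨?_, Family.mem_level _, fun j => rfl⟩
    have : Family.curvature (0 : A.Family X X 1) = 0 := by
      rw [Family.curvature, Family.comp_zero, add_zero]
      funext i j
      simp [Family.diff]
    change Family.curvature (0 : A.Family X X 1) ∈ _
    rw [this]
    exact zero_mem _
  · rintro r hr s hs
    set x : A.Family X X 1 := fun i j => (s i j).1 with hx
    set f : B.Family (fun i => F.obj (X i)) Y.X 0 := fun i j => (s i j).2 with hf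
    obtain ⟨h₁ : Family.curvature x ∈ _, h₂ : Family.defect (Family.map F x) Y.x f ∈ _, h₃⟩ := hs
    set S := Family.defect (Family.map F x) Y.x f with hS
    have key : ∀ i j, ∃ (α : A.Hom (X i) (X j) (i - j + 1))
        (ε : B.Hom (F.obj (X i)) (Y.X j) (i - j + 0)), (j - i < r → α = 0 ∧ ε = 0) ∧
        (j - i = r → j.negOnePow • A.d (show i - j + 1 + 1 = i - j + 2 by lia) α =
          -Family.curvature x i j ∧
          B.comp (show (i - j + 1) + (j - j + 0) = i - j + 1 by lia) (f j j) (F.map α) -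
            j.negOnePow • B.d (show i - j + 0 + 1 = i - j + 1 by lia) ε = S i j) := by
      intro i j
      by_cases hij : j - i = r
      swap
      · exact ⟨0, 0, fun _ => ⟨rfl, rfl⟩, fun h => absurd h hij⟩
      have hdR : Family.diff (show (2 : ℤ) + 1 = 3 by lia) (Family.curvature x) i j = 0 := by
        rw [Family.diff_curvature]
        exact sub_mem (Family.comp_mem_level _ (add_comm 1 r) h₁ (Family.mem_level x))
          (Family.comp_mem_level _ rfl (Family.mem_level x) h₁) i j (by lia)
      have hdS : Family.diff (show (1 : ℤ) + 1 = 2 by lia) (-S) i j =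
          Family.comp (add_zero 2) f (Family.map F (Family.curvature x)) i j := by
        have : Family.diff (show (1 : ℤ) + 1 = 2 by lia) (-S) -
            Family.comp (add_zero 2) f (Family.map F (Family.curvature x)) ∈
              Family.level (fun i => F.obj (X i)) Y.X 2 (r + 1) := by
          have e : Family.diff (show (1 : ℤ) + 1 = 2 by lia) (-S) -
              Family.comp (add_zero 2) f (Family.map F (Family.curvature x)) =
              Family.comp (show (1 : ℤ) + 1 = 2 by lia) Y.x S +
                Family.comp (show (1 : ℤ) + 1 = 2 by lia) S (Family.map F x) := by
            rw [Family.diff_neg, hS, Family.diff_defect _ _ _ hY, Family.map_curvature]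
            abel
          rw [e]
          exact add_mem (Family.comp_mem_level _ rfl (Family.mem_level Y.x) h₂)
            (Family.comp_mem_level _ (add_comm 1 r) h₂ (Family.mem_level _))
        exact Family.apply_eq_of_sub_mem_level this hij
      rw [Family.comp_apply_of_mem_level rfl _ f (Family.map_mem_level F h₁) hij] at hdS
      -- The obstruction cocycle is the curvature together with `-S`, the sign matching
      -- `diff_defect`. As `f j j = φ j j` at every stage, the hypothesis on `φ` applies unchanged.
      obtain ⟨α, ε, hα, hε⟩ := (H j).exists_units_smul (X := X i)
        (show i - j + 0 + 1 = i - j + 1 by lia) (show i - j + 1 + 1 = i - j + 2 by lia)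
        (show i - j + 2 + 1 = i - j + 3 by lia) j.negOnePow (Family.curvature x i j) (-S i j) hdR
        (by rw [← h₃ j]; exact hdS)
      exact ⟨α, ε, fun h => absurd hij h.ne, fun _ => ⟨hα, by
        rw [neg_neg, ← h₃ j] at hε
        exact hε⟩⟩
    choose α ε h0 h1 using key
    have hα : α ∈ Family.level X X 1 r := fun i j hij => (h0 i j hij).1
    have hε : ε ∈ Family.level (fun i => F.obj (X i)) Y.X 0 r := fun i j hij => (h0 i j hij).2
    have hnew := hadd hr (x := x) (f := f) hα hε ⟨h₁, h₂, h₃⟩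
    refine ⟨fun i j => ((x + α) i j, (f + ε) i j), fun i j hij => ?_,
      Family.mem_level_succ hnew.1 fun i j hij => ?_,
      Family.mem_level_succ hnew.2.1 fun i j hij => ?_, hnew.2.2⟩
    · ext
      · simp [hx, (h0 i j hij).1]
      · simp [hf, (h0 i j hij).2]
    · refine (Family.apply_eq_of_sub_mem_level
        (Family.curvature_add_sub_mem_level x hα) hij).trans ?_
      exact (congrArg (Family.curvature x i j + ·) (h1 i j hij).1).trans (add_neg_cancel _)
    · have hd := Family.defect_add_sub_mem_level (Family.map F x) Y.x f hε
        (α := Family.map F α)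
      rw [← map_add] at hd
      refine (Family.apply_eq_of_sub_mem_level hd hij).trans ?_
      rw [Pi.sub_apply, Pi.sub_apply, Pi.sub_apply, Pi.sub_apply,
        Family.comp_apply_of_mem_level rfl _ f (Family.map_mem_level F hα) hij]
      exact sub_eq_zero.2 (h1 i j hij).2.symm

end DGCat

/-! ### Truncation and adding a zero object preserve quasi-equivalences -/

namespace DGCat

variable {k : Type w} [CommRing k] {A : DGCat.{w, u, v} k} {B : DGCat.{w, u', v'} k}

theorem trunc_nonempty_iso_H0 {X Y : A.Obj} (h : Nonempty ((⟨X⟩ : A.H0) ≅ ⟨Y⟩)) :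
    Nonempty ((⟨X⟩ : A.trunc.H0) ≅ ⟨Y⟩) := by
  obtain ⟨f, g, hf, hg, ⟨a, ha⟩, ⟨b, hb⟩⟩ := (nonempty_iso_H0_iff X Y).1 h
  have neg_mem : ∀ {U V : A.Obj} (c : A.Hom U V (-1)), c ∈ A.truncHom U V (-1) := fun c =>
    ⟨fun h => by lia, fun h => by lia⟩
  exact (nonempty_iso_H0_iff (A := A.trunc) X Y).2
    ⟨⟨f, fun _ => hf, fun h => absurd h (lt_irrefl 0)⟩,
      ⟨g, fun _ => hg, fun h => absurd h (lt_irrefl 0)⟩,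
      Subtype.ext hf, Subtype.ext hg, ⟨⟨a, neg_mem a⟩, Subtype.ext ha⟩,
      ⟨⟨b, neg_mem b⟩, Subtype.ext hb⟩⟩

/-- Cohomology is unchanged in degrees `n ≤ 0`, since primitives live in negative degrees, where
truncation removes nothing; above zero both sides vanish. -/
theorem _root_.DGFunctor.QuasiFullyFaithful.truncMap {F : DGFunctor A B}
    (hF : F.QuasiFullyFaithful) : (truncMap F).QuasiFullyFaithful := by
  refine (DGFunctor.quasiFullyFaithful_iff _).2 fun X Y l n m hl hm => ?_
  obtain ⟨h₁, h₂⟩ := (DGFunctor.quasiFullyFaithful_iff _).1 hF X Y hl hm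
  rcases lt_or_ge 0 n with hn | hn
  · refine ⟨fun c _ _ => ⟨0, ?_⟩, fun b _ => ⟨0, 0, map_zero _, ?_⟩⟩
    · rw [IsNonpositive.eq_zero hn c, map_zero]
    · rw [IsNonpositive.eq_zero hn b, map_zero, map_zero, sub_zero]
  · have mem : ∀ c : A.Hom X Y l, c ∈ A.truncHom X Y l := fun c =>
      ⟨fun h => by lia, fun h => by lia⟩
    have mem' : ∀ e : B.Hom (F.obj X) (F.obj Y) l, e ∈ B.truncHom (F.obj X) (F.obj Y) l := fun e =>
      ⟨fun h => by lia, fun h => by lia⟩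
    refine ⟨fun c hc ⟨b, hb⟩ => ?_, fun b hb => ?_⟩
    · obtain ⟨a, ha⟩ := h₁ c.1 (congrArg Subtype.val hc) ⟨b.1, congrArg Subtype.val hb⟩
      exact ⟨⟨a, mem a⟩, Subtype.ext ha⟩
    · obtain ⟨a, e, ha, he⟩ := h₂ b.1 (congrArg Subtype.val hb)
      subst hm
      exact ⟨⟨a, fun _ => ha, fun h => by lia⟩, ⟨e, mem' e⟩, Subtype.ext ha, Subtype.ext he⟩

theorem _root_.DGFunctor.IsQuasiEquivalence.truncMap {F : DGFunctor A B}
    (hF : F.IsQuasiEquivalence) : (truncMap F).IsQuasiEquivalence where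
  quasiFullyFaithful := hF.quasiFullyFaithful.truncMap
  essSurj := (DGFunctor.mapH0_essSurj_iff _).2 fun Y => by
    obtain ⟨X, hX⟩ := F.mapH0_essSurj_iff.1 hF.essSurj Y
    exact ⟨X, trunc_nonempty_iso_H0 hX⟩

theorem _root_.DGFunctor.QuasiFullyFaithful.addZeroMap {F : DGFunctor A B}
    (hF : F.QuasiFullyFaithful) : (addZeroMap F).QuasiFullyFaithful := by
  refine (DGFunctor.quasiFullyFaithful_iff _).2 ?_
  have key : ∀ {X Y : A.addZero.Obj}
      (_ : ∀ {n : ℤ} (f g : A.addZero.Hom X Y n), f = g)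
      (_ : ∀ {n : ℤ} (f g : B.addZero.Hom ((DGCat.addZeroMap F).obj X)
        ((DGCat.addZeroMap F).obj Y) n), f = g) {l n m : ℤ} (hl : l + 1 = n) (hm : n + 1 = m),
      (∀ c : A.addZero.Hom X Y n, A.addZero.d hm c = 0 →
        (∃ b, B.addZero.d hl b = (DGCat.addZeroMap F).map c) → ∃ a, A.addZero.d hl a = c) ∧
      ∀ b : B.addZero.Hom ((DGCat.addZeroMap F).obj X) ((DGCat.addZeroMap F).obj Y) n,
        B.addZero.d hm b = 0 → ∃ a e, A.addZero.d hm a = 0 ∧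
          (DGCat.addZeroMap F).map a - b = B.addZero.d hl e := by
    intro X Y hA hB l n m hl hm
    exact ⟨fun c _ _ => ⟨0, hA _ _⟩, fun b _ => ⟨0, 0, hA _ _, hB _ _⟩⟩
  rintro (_ | X) (_ | Y) l n m hl hm
  · exact key addZero_ext_left addZero_ext_left hl hm
  · exact key addZero_ext_left addZero_ext_left hl hm
  · exact key addZero_ext_right addZero_ext_right hl hm
  · exact (DGFunctor.quasiFullyFaithful_iff _).1 hF X Y hl hm

theorem _root_.DGFunctor.IsQuasiEquivalence.addZeroMap {F : DGFunctor A B}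
    (hF : F.IsQuasiEquivalence) : (addZeroMap F).IsQuasiEquivalence where
  quasiFullyFaithful := hF.quasiFullyFaithful.addZeroMap
  essSurj := (DGFunctor.mapH0_essSurj_iff _).2 fun Y => by
    rcases Y with (_ | Y)
    · exact ⟨none, ⟨Iso.refl _⟩⟩
    · obtain ⟨X, hX⟩ := F.mapH0_essSurj_iff.1 hF.essSurj Y
      obtain ⟨f, g, h⟩ := (nonempty_iso_H0_iff _ _).1 hX
      exact ⟨some X, (nonempty_iso_H0_iff (A := B.addZero) (some (F.obj X)) (some Y)).2 ⟨f, g, h⟩⟩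

/-! ### Twisted complexes and quasi-equivalences -/

/-- Diagonal components have degree `j - j + 0`, which is zero only propositionally; this transports
the identity to that degree. -/
theorem postcompQuasiIso_idCast {F : DGFunctor A B} {X : A.Obj}
    (h : F.PostcompQuasiIso rfl (B.id (F.obj X))) {z : ℤ} (hz : z = 0) (hz' : 0 = z) :
    F.PostcompQuasiIso hz (B.idCast (rfl : F.obj X = F.obj X) hz') := by
  subst hz
  exact h

section

variable [A.IsNonpositive] [B.IsNonpositive]

theorem _root_.DGFunctor.QuasiFullyFaithful.twNonposMap {F : DGFunctor A B}
    (hF : F.QuasiFullyFaithful) : (twNonposMap F).QuasiFullyFaithful := by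
  refine DGFunctor.quasiFullyFaithful_of_postcompQuasiIso_id fun X => ?_
  refine twNonposMap_postcompQuasiIso F (X' := X) (Y' := X.map F) (Family.id _)
    (twDiff_id (X.map F)) fun j => ?_
  rw [show Family.id (X.map F).X j j = B.idCast rfl (by lia) by simp [Family.id]]
  exact postcompQuasiIso_idCast (hF.postcompQuasiIso_id (X.X j)) _ _

/-- A closed morphism of degree zero of twisted complexes whose diagonal components induce
quasi-isomorphisms by postcomposition is a homotopy equivalence. -/
theorem TwistedComplex.nonempty_iso_H0 {X Y : A.TwistedComplex} (f : A.Family X.X Y.X 0)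
    (hf : twDiff (X := X) (Y := Y) (zero_add 1) f = 0)
    (H : ∀ j, DGFunctor.PostcompQuasiIso (𝟙 A : A ⟶ A) (X' := X.X j)
      (show j - j + 0 = 0 by lia) (f j j)) :
    Nonempty ((⟨X⟩ : A.twNonpos.H0) ≅ ⟨Y⟩) :=
  nonempty_iso_H0_of_postcompQuasiIso (A := A.twNonpos) f hf
    (twNonposMap_postcompQuasiIso (𝟙 A : A ⟶ A) (X' := X) (Y' := Y) f hf H)

theorem _root_.DGFunctor.IsQuasiEquivalence.twNonposMap {F : DGFunctor A B}
    (hF : F.IsQuasiEquivalence) : (twNonposMap F).IsQuasiEquivalence where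
  quasiFullyFaithful := hF.quasiFullyFaithful.twNonposMap
  essSurj := (DGFunctor.mapH0_essSurj_iff _).2 fun (Y : B.TwistedComplex) => by
    choose X hX using fun j => F.mapH0_essSurj_iff.1 hF.essSurj (Y.X j)
    -- Two properties of the diagonal are needed: relative to `F`, to solve for the twisted
    -- structure on `X`; relative to the identity of `B`, to recognise the resulting morphism as a
    -- homotopy equivalence.
    have hφ : ∀ i j, ∃ φ : B.Hom (F.obj (X i)) (Y.X j) (i - j + 0), ∀ h : i = j,
        F.PostcompQuasiIso (show i - j + 0 = 0 by lia) φ ∧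
          DGFunctor.PostcompQuasiIso (𝟙 B : B ⟶ B) (X' := F.obj (X i))
            (show i - j + 0 = 0 by lia) φ := by
      intro i j
      by_cases h : i = j
      · subst h
        obtain ⟨φ, ψ, hφ, hψ, hψφ, hφψ⟩ := (nonempty_iso_H0_iff _ _).1 (hX i)
        have key : ∀ {z : ℤ} (hz : z = 0), ∃ φ : B.Hom (F.obj (X i)) (Y.X i) z,
            F.PostcompQuasiIso hz φ ∧
              DGFunctor.PostcompQuasiIso (𝟙 B : B ⟶ B) (X' := F.obj (X i)) hz φ := by
          rintro _ rfl
          exact ⟨φ, hF.quasiFullyFaithful.postcompQuasiIso hφ hψ hψφ hφψ,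
          (DGFunctor.quasiFullyFaithful_id B).postcompQuasiIso (X' := F.obj (X i)) hφ hψ hψφ hφψ⟩
        obtain ⟨φ, h⟩ := key (show i - i + 0 = 0 by lia)
        exact ⟨φ, fun _ => h⟩
      · exact ⟨0, fun h' => absurd h' h⟩
    choose φ hφ using hφ
    obtain ⟨x, f, hx, hf, hfφ⟩ := exists_curvature_eq_zero F X Y φ fun j => (hφ j j rfl).1
    let X' : A.TwistedComplex := ⟨X, x, fun i j => congrFun (congrFun hx i) j⟩
    refine ⟨X', TwistedComplex.nonempty_iso_H0 (X := X'.map F) (Y := Y) f ?_ fun j => ?_⟩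
    -- In degree zero the sign is trivial and the twisted differential is exactly the defect.
    · refine (twDiff_eq (X := X'.map F) (Y := Y) (zero_add 1) f).trans ?_
      rw [Int.negOnePow_zero, one_smul, ← add_sub_assoc]
      exact hf
    · have := (hφ j j rfl).2
      rw [← hfφ j] at this
      exact this

end

/-! ### Arbitrary dg-categories, zigzags and the homotopy category -/

theorem _root_.DGFunctor.QuasiFullyFaithful.twMap {F : DGFunctor A B}
    (hF : F.QuasiFullyFaithful) : (twMap F).QuasiFullyFaithful :=
  hF.addZeroMap.truncMap.twNonposMap

theorem _root_.DGFunctor.IsQuasiEquivalence.twMap {F : DGFunctor A B}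
    (hF : F.IsQuasiEquivalence) : (twMap F).IsQuasiEquivalence :=
  hF.addZeroMap.truncMap.twNonposMap

theorem QuasiEquivalent.tw {A B : DGCat.{w, u, v} k} (h : A.QuasiEquivalent B) :
    A.tw.QuasiEquivalent B.tw := by
  induction h with
  | rel A B h => exact .rel _ _ ⟨DGCat.twMap h.choose, h.choose_spec.twMap⟩
  | refl A => exact .refl _
  | symm A B _ ih => exact .symm _ _ ih
  | trans A B C _ _ ih₁ ih₂ => exact .trans _ _ _ ih₁ ih₂

theorem twFunctor_isInvertedBy :
    (quasiEquivalences.{w, u, v} k).IsInvertedBy (twFunctor ⋙ toHqe) := fun _ _ F hF =>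
  (quasiEquivalences k).Q_inverts (DGCat.twMap F) hF.twMap

/-- By the universal property `Tw` descends to a functor between the localizations. It agrees with
`Tw` on objects by definition, so applying it to the isomorphism suffices. -/
theorem nonempty_toHqe_tw_iso {A B : DGCat.{w, u, v} k}
    (h : Nonempty (toHqe.obj A ≅ toHqe.obj B)) :
    Nonempty (toHqe.obj A.tw ≅ toHqe.obj B.tw) := by
  obtain ⟨e⟩ := h
  exact ⟨(Localization.Construction.lift _ twFunctor_isInvertedBy).mapIso e⟩

end DGCat

theorem mainTheorem4 {k : Type w} [CommRing k] :
    -- `Tw` preserves quasi-fully faithful dg-functors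
    (∀ (A : DGCat.{w, u, v} k) (B : DGCat.{w, u', v'} k) (F : DGFunctor A B),
      F.QuasiFullyFaithful → (DGCat.twMap F).QuasiFullyFaithful) ∧
    -- `Tw` preserves quasi-equivalences
    (∀ (A : DGCat.{w, u, v} k) (B : DGCat.{w, u', v'} k) (F : DGFunctor A B),
      F.IsQuasiEquivalence → (DGCat.twMap F).IsQuasiEquivalence) ∧
    -- the same for the direct definition of `Tw`, which does not add a formal zero object, on
    -- dg-categories strictly concentrated in nonpositive degrees and with strict zero objects
    (∀ (A : DGCat.{w, u, v} k) (B : DGCat.{w, u', v'} k) [A.IsNonpositive] [B.IsNonpositive], A.HasStrictZero →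
      B.HasStrictZero → ∀ F : DGFunctor A B,
        (F.QuasiFullyFaithful → (DGCat.twNonposMap F).QuasiFullyFaithful) ∧
        (F.IsQuasiEquivalence → (DGCat.twNonposMap F).IsQuasiEquivalence)) ∧
    -- quasi-equivalent dg-categories have quasi-equivalent dg-categories of twisted complexes
    (∀ A B : DGCat.{w, u, v} k, A.QuasiEquivalent B → A.tw.QuasiEquivalent B.tw) ∧
    -- dg-categories isomorphic in `Hqe` have isomorphic dg-categories of twisted complexes in `Hqe`
    (∀ A B : DGCat.{w, u, v} k, Nonempty (DGCat.toHqe.obj A ≅ DGCat.toHqe.obj B) →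
      Nonempty (DGCat.toHqe.obj A.tw ≅ DGCat.toHqe.obj B.tw)) :=
  ⟨fun _ _ _ hF => hF.twMap, fun _ _ _ hF => hF.twMap,
    fun _ _ _ _ _ _ _ => ⟨fun hF => hF.twNonposMap, fun hF => hF.twNonposMap⟩,
    fun _ _ h => h.tw, fun _ _ h => DGCat.nonempty_toHqe_tw_iso h⟩
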